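/- Let $X$ be a separable complex Hilbert space and let $H^2(\mathbb D,X)$ be the Hardy space of $X$-valued power series $f(z)=\sum_{n\ge0}\hat f(n)z^n$ with $\|f\|^2=\sum_n\|\hat f(n)\|_X^2<\infty$; write $H^2=H^2(\mathbb D,\mathbb C)$. Let $Sf=zf$ and $S^*f=(f-f(0))/z$. For $f\in H^2(\mathbb D,X)$ let $E_f$ be the closed linear span of $\{S^{*n}f:n\ge0\}$; $f$ is cyclic if $E_f=H^2(\mathbb D,X)$. Let $\mathcal P_N(X)\subset H^2(\mathbb D,X)$ be the space of $X$-valued polynomials of degree at most $N$, with the inherited inner product, and for a linear subspace $L\subset\mathcal P_N(X)$ let $H^2\otimes L$ be the closure in $H^2(\mathbb D,X)$ of the set of finite sums $\sum_j h_jp_j$ with $h_j\in H^2$, $p_j\in L$ (and $H^2\otimes g:=H^2\otimes\mathbb Cg$). A sequence $(a_k)$ in a Hilbert space is completely relatively compact (c.r.c.) if for every orthogonal projection $P$ the set $\{Pa_k/\|Pa_k\|: Pa_k\ne0\}$ is relatively compact. Let $N\ge0$, let $(n_k)_{k\ge1}$ be a strictly increasing lacunary sequence of nonnegative integers (there is $d>1$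 with $n_{k+1}\ge d\,n_k$ for all $k$), let $(P_k)_{k\ge1}$ be a c.r.c. sequence in $\mathcal P_N(X)$, and suppose that $f(z)=\sum_{k\ge1}P_k(z)z^{n_k}$ belongs to $H^2(\mathbb D,X)$. Then there is exactly one closed subspace $L\subset\mathcal P_N(X)$ such that $H^2\otimes L\subset\bigcap_{k\ge0}E_{S^{*k}f}$ and such that every $g\in\mathcal P_N(X)$ with $H^2\otimes g\subset E_f$ belongs to $L$. Put $F=H^2\otimes L$. Then: (i) $SF\subset F\subset\bigcap_{k\ge0}E_{S^{*k}f}\subset E_f$. (ii) $f=g+p$ with $g\in F$ and $p$ an $X$-valued polynomial. (iii) $\bigcap_{k\ge0}E_{S^{*k}f}=\operatorname{clos}(F+S^*L+\dots+S^{*N}L)$, and there is $d\ge0$ such that $S^{*d}f\in\operatorname{clos}(F+S^*L+\dots+S^{*N}L)$ and $\operatorname{clos}(S^{*d}E_f)=\operatorname{clos}(F+S^*L+\dots+S^{*N}L)$; if $\dim X<\infty$, then moreover, for this $d$, $S^{*d}E_f=\operatorname{clos}(F+S^*L+\dots+S^{*N}L)$ without closure on the left. (iv) If $\dim X<\infty$,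 then $f$ is cyclic if and only if $L$ has full local rank, that is, $$\dim X=\max_{|z|<1}\dim\operatorname{span}\{p(z):p\in L\}.$$ -/

import Mathlib

open scoped ENNReal

namespace Hardy

/-- The Hardy space `H²(𝔻, X)`, in its description as the space `ℓ²_a(X)` of power series
`f(z) = ∑ f̂(n) zⁿ` with `∑ ‖f̂(n)‖² < ∞`; the `n`-th Taylor coefficient of `f` is `f n`, and the
norm is the Hardy norm `‖f‖² = ∑ ‖f̂(n)‖²`. -/
abbrev H2 (X : Type*) [NormedAddCommGroup X] : Type _ := lp (fun _ : ℕ => X) 2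

section Shifts

/-- The coefficients of `z f(z)`. -/
def shiftFun {X : Type*} [NormedAddCommGroup X] (a : ℕ → X) : ℕ → X
  | 0 => 0
  | n + 1 => a n

theorem memlp_two_iff {X : Type*} [NormedAddCommGroup X] (a : ℕ → X) : Memℓp a 2 ↔ Summable fun n => ‖a n‖ ^ 2 := by
  rw [memℓp_gen_iff (by norm_num)]
  simp

theorem memlp_shiftFun {X : Type*} [NormedAddCommGroup X] (f : H2 X) : Memℓp (E := fun _ : ℕ => X) (shiftFun (f : ℕ → X)) 2 := by
  rw [memlp_two_iff, ← summable_nat_add_iff 1]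
  exact (memlp_two_iff _).1 (lp.memℓp f)

theorem memlp_backwardFun {X : Type*} [NormedAddCommGroup X] (f : H2 X) :
    Memℓp (E := fun _ : ℕ => X) (fun n => (f : ℕ → X) (n + 1)) 2 := by
  rw [memlp_two_iff, summable_nat_add_iff (f := fun n => ‖(f : ℕ → X) n‖ ^ 2) 1]
  exact (memlp_two_iff _).1 (lp.memℓp f)

variable {X : Type*} [NormedAddCommGroup X] [InnerProductSpace ℂ X]

/-- The shift `S f = z f`. -/
noncomputable def shift : H2 X →ₗ[ℂ] H2 X where
  toFun f := ⟨shiftFun (f : ℕ → X), memlp_shiftFun f⟩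
  map_add' f g := by
    ext n
    cases n
    · exact (add_zero (0 : X)).symm
    · rfl
  map_smul' c f := by
    ext n
    cases n
    · exact (smul_zero c).symm
    · rfl

/-- The backward shift `S* f = (f - f(0)) / z`. -/
noncomputable def backwardShift : H2 X →ₗ[ℂ] H2 X where
  toFun f := ⟨fun n => (f : ℕ → X) (n + 1), memlp_backwardFun f⟩
  map_add' f g := by
    ext n
    rfl
  map_smul' c f := by
    ext n
    rfl

/-- The closed `S*`-invariant subspace `E_f`: the closed linear span of `S*ⁿ f`, `n ≥ 0`. -/
noncomputable def orbitSpan (f : H2 X) : Submodule ℂ (H2 X) :=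
  (Submodule.span ℂ (Set.range fun n : ℕ => (backwardShift ^ n) f)).topologicalClosure

/-- `f` is cyclic for the backward shift: `E_f = H²(𝔻, X)`. -/
def IsCyclic (f : H2 X) : Prop := orbitSpan f = ⊤

end Shifts

section Polynomials

variable (X : Type*) [NormedAddCommGroup X] [InnerProductSpace ℂ X]

/-- The space `𝒫_N(X)` of `X`-valued polynomials of degree at most `N`, as a subspace of
`H²(𝔻, X)` (with the inherited inner product). -/
def polyLE (N : ℕ) : Submodule ℂ (H2 X) where
  carrier := {f | ∀ n, N < n → (f : ℕ → X) n = 0}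
  zero_mem' := by
    intro n _
    simp
  add_mem' := by
    intro f g hf hg n hn
    simp [hf n hn, hg n hn]
  smul_mem' := by
    intro c f hf n hn
    simp [hf n hn]

end Polynomials

section Tensor

variable {X : Type*} [NormedAddCommGroup X] [InnerProductSpace ℂ X]

/-- `u` is the product `h p` of the scalar function `h ∈ H²` and of `p`, both read as power
series (Cauchy product of the coefficients). -/
def IsProduct (h : H2 ℂ) (p u : H2 X) : Prop :=
  ∀ n : ℕ, (u : ℕ → X) n =
    ∑ ij ∈ Finset.HasAntidiagonal.antidiagonal n, (h : ℕ → ℂ) ij.1 • (p : ℕ → X) ij.2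

/-- `H² ⊗ L`: the closure in `H²(𝔻, X)` of the set of finite sums `∑ h_j p_j` with `h_j ∈ H²`
and `p_j ∈ L`. -/
noncomputable def tensor (L : Submodule ℂ (H2 X)) : Submodule ℂ (H2 X) :=
  (Submodule.span ℂ {u : H2 X | ∃ h : H2 ℂ, ∃ p ∈ L, IsProduct h p u}).topologicalClosure

/-- `L` is the maximal closed subspace of `𝒫_N(X)` attached to `f`: one has
`H² ⊗ L ⊆ ⋂_k E_{S*^k f}`, and every `g ∈ 𝒫_N(X)` with `H² ⊗ g ⊆ E_f` belongs to `L`. -/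
structure IsMaximalBlockSpace (f : H2 X) (N : ℕ) (L : Submodule ℂ (H2 X)) : Prop where
  le_polyLE : L ≤ polyLE X N
  isClosed : IsClosed (L : Set (H2 X))
  tensor_le : tensor L ≤ ⨅ k : ℕ, orbitSpan ((backwardShift ^ k) f)
  maximal : ∀ g ∈ polyLE X N, tensor (Submodule.span ℂ {g}) ≤ orbitSpan f → g ∈ L

/-- The closure of `F + S* L + ⋯ + S*^N L`, where `F = H² ⊗ L`. -/
noncomputable def blockSum (N : ℕ) (L : Submodule ℂ (H2 X)) : Submodule ℂ (H2 X) :=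
  (tensor L ⊔ ⨆ i ∈ Finset.Icc 1 N, L.map (backwardShift ^ i)).topologicalClosure

/-- The value `f(z) = ∑ f̂(n) zⁿ`, for `|z| < 1`. -/
noncomputable def eval (f : H2 X) (z : ℂ) : X := ∑' n : ℕ, z ^ n • (f : ℕ → X) n

/-- `dim (p(z) : p ∈ L)`, the dimension of the linear span of the values at `z`. -/
noncomputable def rankAt (L : Submodule ℂ (H2 X)) (z : ℂ) : ℕ :=
  Module.finrank ℂ (Submodule.span ℂ ((fun p => eval p z) '' (L : Set (H2 X))))

end Tensor

/-- Hadamard lacunary sequences of nonnegative integers: increasing, with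
`n_{k+1} ≥ d n_k` for all `k` and some constant `d > 1`. -/
def IsLacunary (n : ℕ → ℕ) : Prop :=
  StrictMono n ∧ ∃ d : ℝ, 1 < d ∧ ∀ k, d * (n k : ℝ) ≤ (n (k + 1) : ℝ)

/-- A sequence `a` in a Hilbert space is completely relatively compact (c.r.c.): for every
orthogonal projection `P` (onto a closed subspace `K`), the normalized vectors
`P a_k / ‖P a_k‖`, over those `k` with `P a_k ≠ 0`, form a relatively compact set. -/
def IsCRC {E : Type*} [NormedAddCommGroup E] [InnerProductSpace ℂ E] (a : ℕ → E) : Prop :=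
  ∀ (K : Submodule ℂ E) [K.HasOrthogonalProjection],
    IsCompact (closure {x : E | ∃ k, K.starProjection (a k) ≠ 0 ∧
      x = ((‖K.starProjection (a k)‖⁻¹ : ℝ) : ℂ) • K.starProjection (a k)})

/-- `f = ∑ P_k(z) z^{n_k}` as power series: each Taylor coefficient of `f` is the sum of the
corresponding coefficients of the terms `S^{n_k} P_k = P_k(z) z^{n_k}`. -/
def IsBlockSeries {X : Type*} [NormedAddCommGroup X] [InnerProductSpace ℂ X] {N : ℕ}
    (f : H2 X) (n : ℕ → ℕ) (P : ℕ → polyLE X N) : Prop :=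
  ∀ m : ℕ, HasSum (fun k => ((shift ^ n k) (P k : H2 X) : ℕ → X) m) ((f : ℕ → X) m)

end Hardy

/-!
Write `E_f` for `orbitSpan f`. A polynomial `p` satisfies `H² ⊗ p ⊆ E_f` exactly when `z^j p ∈ E_f`
for all `j`, and the polynomials of degree at most `N` with this property form the closed subspace
`blockSpace f N`. Since `S*^k (z^{j+k} p) = z^j p`, the same polynomials then satisfy
`z^j p ∈ E_{S*^k f}` for all `k`. This gives existence and uniqueness of `L`, and (i).

The core is that `P_k ∈ L` for all large `k` (`exists_forall_mem_blockSpace`). For large `k`,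
`S*^{n_k - j} f` is `z^j` times the tail `P_k + ∑_{i > k} P_i z^{n_i - n_k}`. Modulo `H² ⊗ L ⊆ E_f`
the blocks `P_i` may be replaced by their components `v_i` orthogonal to `L`. Suppose that
infinitely many `v_i` are nonzero and put `r_k = ∑_{i > k} ‖v_i‖²`. By lacunarity there is `q` such
that, for `i` restricted to one residue class modulo `q`, the remainders
`∑_{i > k} v_i z^{n_i - n_k}` for different `k` have disjoint supports and so are orthogonal. Thus a
combination of the remainders with coefficients `b_k` has norm at most `q (∑ |b_k|² r_k)^{1/2}`
(`norm_sum_tail_sub_le`). By Abel–Dini `∑ ‖v_k‖² / r_k = ∞` (`not_summable_div_tail`),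
and by complete relative compactness this divergence
is already carried by indices whose directions `v_k / ‖v_k‖` are arbitrarily close to a single unit
vector `u`. With `b_k` proportional to `‖v_k‖ / r_k` over such indices and `∑ b_k ‖v_k‖ = 1`, the
combinations of the tails converge to `u` (`exists_mem_closure_span_tail`). Hence `z^j u ∈ E_f` for
all `j`, that is `u ∈ L`, although `u` is a unit vector orthogonal to `L`.

So `f` is an element of `H² ⊗ L` up to a polynomial, which is (ii). The backward shift removes the
polynomial, and `clos (F + S* L + ⋯ + S*^N L)` is `S*`-invariant and contained in every
`E_{S*^k f}`; this gives (iii). If `dim X < ∞`, the kernel of `S*^d` is finite-dimensional,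
so `S*^d E_f` is closed.

For (iv), a cyclic `f` has `L` equal to the space of all polynomials of degree at most `N` by
maximality. Conversely, polynomials in `L` whose values form a basis of `X` at one point have a
nonzero determinant `δ`, and Cramer's rule gives `δ z^m x ∈ H² ⊗ L` for all `m` and `x`. Applying
`S*^D`, with `D` the degree of `δ`, and inducting on `m` shows `z^m x ∈ E_f`
(`eq_top_of_aeval_shift_mem`).
-/

open scoped ENNReal

namespace Hardy

/-! ### Coefficients, shifts and norms -/

section Basic

variable {X : Type*} [NormedAddCommGroup X]

theorem hasSum_norm_sq_coeff (f : H2 X) : HasSum (fun m => ‖(f : ℕ → X) m‖ ^ 2) (‖f‖ ^ 2) := by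
  have h := lp.hasSum_norm (p := 2) (by norm_num) f
  simpa using h

theorem sum_coeff {ι : Type*} (s : Finset ι) (F : ι → H2 X) (m : ℕ) :
    ((∑ i ∈ s, F i : H2 X) : ℕ → X) m = ∑ i ∈ s, (F i : ℕ → X) m := by
  rw [lp.coeFn_sum, Finset.sum_apply]

variable [InnerProductSpace ℂ X]

theorem hasSum_coeff {ι : Type*} {F : ι → H2 X} {g : H2 X} (h : HasSum F g) (m : ℕ) :
    HasSum (fun i => (F i : ℕ → X) m) ((g : ℕ → X) m) :=
  h.mapL (lp.evalCLM ℂ (fun _ : ℕ => X) 2 m)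

theorem shift_pow_coeff (e : ℕ) (f : H2 X) (m : ℕ) :
    ((shift ^ e) f : ℕ → X) m = if e ≤ m then (f : ℕ → X) (m - e) else 0 := by
  induction e generalizing m with
  | zero => simp
  | succ e ih =>
    rw [pow_succ', Module.End.mul_apply]
    cases m with
    | zero => rfl
    | succ m =>
      refine (ih m).trans ?_
      simp

theorem shift_pow_coeff_add (e : ℕ) (f : H2 X) (m : ℕ) :
    ((shift ^ e) f : ℕ → X) (m + e) = (f : ℕ → X) m := by
  simp [shift_pow_coeff]

theorem backwardShift_pow_coeff (e : ℕ) (f : H2 X) (m : ℕ) :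
    ((backwardShift ^ e) f : ℕ → X) m = (f : ℕ → X) (m + e) := by
  induction e generalizing m with
  | zero => simp
  | succ e ih =>
    rw [pow_succ', Module.End.mul_apply]
    refine (ih (m + 1)).trans ?_
    rw [add_assoc, add_comm 1 e]

theorem backwardShift_pow_shift_pow (e : ℕ) (f : H2 X) :
    (backwardShift ^ e) ((shift ^ e) f) = f := by
  ext m
  simp [backwardShift_pow_coeff, shift_pow_coeff]

theorem backwardShift_pow_add_shift_pow (a b : ℕ) (f : H2 X) :
    (backwardShift ^ a) ((shift ^ (a + b)) f) = (shift ^ b) f := by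
  rw [pow_add, Module.End.mul_apply, backwardShift_pow_shift_pow]

theorem norm_shift_pow (e : ℕ) (f : H2 X) : ‖(shift ^ e) f‖ = ‖f‖ := by
  have h1 := hasSum_norm_sq_coeff ((shift ^ e) f)
  rw [← hasSum_nat_add_iff' e] at h1
  have h2 : ∑ i ∈ Finset.range e, ‖((shift ^ e) f : ℕ → X) i‖ ^ 2 = 0 := by
    refine Finset.sum_eq_zero fun i hi => ?_
    rw [shift_pow_coeff, if_neg (by simpa using hi)]
    simp
  simp only [h2, sub_zero, shift_pow_coeff_add] at h1
  exact (sq_eq_sq₀ (norm_nonneg _) (norm_nonneg _)).1 (h1.unique (hasSum_norm_sq_coeff f))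

theorem norm_backwardShift_pow_le (e : ℕ) (f : H2 X) : ‖(backwardShift ^ e) f‖ ≤ ‖f‖ := by
  rw [← sq_le_sq₀ (norm_nonneg _) (norm_nonneg _)]
  have h1 := hasSum_norm_sq_coeff f
  have h2 := hasSum_norm_sq_coeff ((backwardShift ^ e) f)
  simp only [backwardShift_pow_coeff] at h2
  rw [← hasSum_nat_add_iff' e] at h1
  rw [h2.unique h1]
  exact sub_le_self _ (Finset.sum_nonneg fun i _ => by positivity)

/-- The power `Sᵉ` of the shift, as a linear isometry. -/
noncomputable def shiftIsometry (e : ℕ) : H2 X →ₗᵢ[ℂ] H2 X where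
  toLinearMap := shift ^ e
  norm_map' := norm_shift_pow e

theorem continuous_shift_pow (e : ℕ) : Continuous (shift ^ e : H2 X →ₗ[ℂ] H2 X) :=
  (shiftIsometry e).continuous

theorem continuous_backwardShift_pow (e : ℕ) :
    Continuous (backwardShift ^ e : H2 X →ₗ[ℂ] H2 X) :=
  ((backwardShift ^ e : H2 X →ₗ[ℂ] H2 X).mkContinuous 1
    (fun f => by simpa using norm_backwardShift_pow_le e f)).continuous

theorem continuous_coeff (m : ℕ) : Continuous fun f : H2 X => (f : ℕ → X) m :=
  (lp.evalCLM ℂ (fun _ : ℕ => X) 2 m).continuous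

theorem isClosed_polyLE (N : ℕ) : IsClosed (polyLE X N : Set (H2 X)) := by
  have : (polyLE X N : Set (H2 X)) = ⋂ m, ⋂ (_ : N < m), {f : H2 X | (f : ℕ → X) m = 0} := by
    ext f
    simp only [Set.mem_iInter]
    rfl
  rw [this]
  exact isClosed_iInter fun m => isClosed_iInter fun _ =>
    isClosed_eq (continuous_coeff m) continuous_const

/-- Series with disjoint supports are orthogonal. -/
theorem inner_eq_zero_of_disjoint {f g : H2 X}
    (h : ∀ m, (f : ℕ → X) m = 0 ∨ (g : ℕ → X) m = 0) : inner ℂ f g = 0 := by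
  rw [lp.inner_eq_tsum, ← tsum_zero (α := ℂ) (β := ℕ)]
  refine tsum_congr fun m => ?_
  rcases h m with h | h <;> simp [h]

theorem shift_pow_coeff_ne_zero {N e m : ℕ} {p : H2 X} (hp : p ∈ polyLE X N)
    (h : ((shift ^ e) p : ℕ → X) m ≠ 0) : e ≤ m ∧ m ≤ e + N := by
  rw [shift_pow_coeff] at h
  have h1 : e ≤ m := by
    by_contra h1
    exact h (if_neg h1)
  refine ⟨h1, ?_⟩
  by_contra h2
  rw [if_pos h1] at h
  exact h (hp _ (by omega))

end Basic

/-! ### Series of shifted polynomials with separated exponents -/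

section Blocks

variable {X : Type*} [NormedAddCommGroup X] [InnerProductSpace ℂ X] {N : ℕ}

theorem orthogonalFamily_shift {e : ℕ → ℕ} (he : ∀ i j, i < j → e i + N < e j) :
    OrthogonalFamily ℂ (fun _ : ℕ => polyLE X N)
      (fun i => (shiftIsometry (e i)).comp (polyLE X N).subtypeₗᵢ) := by
  intro i j hij v w
  refine inner_eq_zero_of_disjoint fun m => ?_
  by_contra! h
  have h1 := shift_pow_coeff_ne_zero v.2 h.1
  have h2 := shift_pow_coeff_ne_zero w.2 h.2
  rcases lt_or_gt_of_ne hij with h | h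
  · have := he _ _ h
    omega
  · have := he _ _ h
    omega

/-- The series `∑ v_i(z) z^{e_i}` in `H²(𝔻, X)`. It is meaningful for separated exponents and
square-summable blocks, when it converges in norm. -/
noncomputable def blocks (e : ℕ → ℕ) (v : ℕ → polyLE X N) : H2 X :=
  ∑' i, (shift ^ e i) (v i : H2 X)

theorem hasSum_blocks [CompleteSpace X] {e : ℕ → ℕ} (he : ∀ i j, i < j → e i + N < e j)
    {v : ℕ → polyLE X N} (hv : Summable fun i => ‖v i‖ ^ 2) :
    HasSum (fun i => (shift ^ e i) (v i : H2 X)) (blocks e v) :=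
  (((orthogonalFamily_shift he).summable_iff_norm_sq_summable v).2 hv).hasSum

theorem norm_blocks_sq [CompleteSpace X] {e : ℕ → ℕ} (he : ∀ i j, i < j → e i + N < e j)
    {v : ℕ → polyLE X N} (hv : Summable fun i => ‖v i‖ ^ 2) :
    ‖blocks e v‖ ^ 2 = ∑' i, ‖v i‖ ^ 2 := by
  refine tendsto_nhds_unique ((hasSum_blocks he hv).norm.pow 2) ?_
  exact Filter.Tendsto.congr (fun s => ((orthogonalFamily_shift he).norm_sum v s).symm) hv.hasSum

theorem blocks_coeff_ne_zero [CompleteSpace X] {e : ℕ → ℕ}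
    (he : ∀ i j, i < j → e i + N < e j) {v : ℕ → polyLE X N} (hv : Summable fun i => ‖v i‖ ^ 2)
    {m : ℕ} (h : (blocks e v : ℕ → X) m ≠ 0) : ∃ i, v i ≠ 0 ∧ e i ≤ m ∧ m ≤ e i + N := by
  by_contra! hc
  refine h ((hasSum_coeff (hasSum_blocks he hv) m).unique ?_)
  convert hasSum_zero using 2 with i
  by_contra hi
  have h1 := shift_pow_coeff_ne_zero (v i).2 hi
  have h2 := hc i (fun h0 => hi (by simp [h0])) h1.1
  omega

theorem eq_blocks [CompleteSpace X] {e : ℕ → ℕ} (he : ∀ i j, i < j → e i + N < e j)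
    {v : ℕ → polyLE X N} (hv : Summable fun i => ‖v i‖ ^ 2) {g : H2 X}
    (hg : ∀ m, HasSum (fun i => ((shift ^ e i) (v i : H2 X) : ℕ → X) m) ((g : ℕ → X) m)) :
    g = blocks e v := by
  ext m
  exact (hg m).unique (hasSum_coeff (hasSum_blocks he hv) m)

/-- The blocks of a series with separated exponents are square-summable: they occupy disjoint
windows of coefficients. -/
theorem summable_norm_sq_of_blocks {e : ℕ → ℕ} (he : ∀ i j, i < j → e i + N < e j)
    {v : ℕ → polyLE X N} {g : H2 X}
    (hg : ∀ m, HasSum (fun i => ((shift ^ e i) (v i : H2 X) : ℕ → X) m) ((g : ℕ → X) m)) :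
    Summable fun i => ‖v i‖ ^ 2 := by
  have hcoef : ∀ i, ∀ r ≤ N, (g : ℕ → X) (r + e i) = ((v i : H2 X) : ℕ → X) r := by
    intro i r hr
    refine (hg (r + e i)).unique ?_
    rw [← shift_pow_coeff_add (e i) (v i : H2 X) r]
    refine hasSum_single i fun j hj => ?_
    by_contra h
    have h1 := shift_pow_coeff_ne_zero (v j).2 h
    rcases lt_or_gt_of_ne hj with h | h
    · have := he _ _ h
      omega
    · have := he _ _ h
      omega
  have hinj : Function.Injective e := by
    intro i j hij
    by_contra hne
    rcases lt_or_gt_of_ne hne with h | h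
    · have := he _ _ h
      omega
    · have := he _ _ h
      omega
  have hsum : Summable fun i => ∑ r ∈ Finset.range (N + 1), ‖(g : ℕ → X) (r + e i)‖ ^ 2 := by
    refine summable_sum fun r _ => ?_
    exact (hasSum_norm_sq_coeff g).summable.comp_injective
      (i := fun i => r + e i) ((add_right_injective r).comp hinj)
  convert hsum using 2 with i
  refine (hasSum_norm_sq_coeff (v i : H2 X)).unique ?_
  rw [Finset.sum_congr rfl fun r hr => by rw [hcoef i r (by simpa [Nat.lt_succ_iff] using hr)]]
  refine hasSum_sum_of_ne_finset_zero fun r hr => ?_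
  rw [(v i).2 r (by simpa using hr)]
  simp

end Blocks

/-! ### Differences of a lacunary sequence -/

theorem IsLacunary.exists_gap {n : ℕ → ℕ} (hn : IsLacunary n) (N : ℕ) :
    ∃ K, ∀ i j, K ≤ i → i < j → n i + N < n j := by
  obtain ⟨hmono, d, hd, hdn⟩ := hn
  obtain ⟨K, hK⟩ := exists_nat_gt ((N : ℝ) / (d - 1))
  refine ⟨K, fun i j hi hij => ?_⟩
  have hle : n (i + 1) ≤ n j := hmono.monotone hij
  have h1 : (K : ℝ) ≤ n i := by exact_mod_cast hi.trans hmono.le_apply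
  have h2 : (N : ℝ) < (d - 1) * n i := by
    rw [div_lt_iff₀ (by linarith)] at hK
    nlinarith
  have h3 := hdn i
  have h4 : (n i : ℝ) + N < n (i + 1) := by linarith
  exact lt_of_lt_of_le (by exact_mod_cast h4) hle

/-- The differences `n i - n k`, `k < i`, with `i` in a fixed residue class modulo a large `q`
separate different values of `i`: if `(d - 1) d ^ m ≥ 1` and `i + m < i'`, then
`n i' - n k' ≥ (d - 1) n (i' - 1) ≥ n i`, and `n i` exceeds `n i - n k` by more than `N` once
`n k > N`. -/
theorem IsLacunary.exists_separation {n : ℕ → ℕ} (hn : IsLacunary n) (N : ℕ) :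
    ∃ K q, 0 < q ∧ ∀ k i k' i', K ≤ k → k' < i' → i + q ≤ i' →
      n i + n k' + N < n i' + n k := by
  obtain ⟨hmono, d, hd, hdn⟩ := hn
  obtain ⟨q, hq⟩ := pow_unbounded_of_one_lt (d / (d - 1)) hd
  have hpow : ∀ i m, d ^ m * (n i : ℝ) ≤ n (i + m) := by
    intro i m
    induction m with
    | zero => simp
    | succ m ih =>
      calc d ^ (m + 1) * (n i : ℝ) = d * (d ^ m * n i) := by ring
        _ ≤ d * n (i + m) := by gcongr
        _ ≤ n (i + (m + 1)) := hdn (i + m)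
  refine ⟨N + 1, q + 1, Nat.succ_pos q, fun k i k' i' hk hk' hi => ?_⟩
  have h1 : N < n k := lt_of_lt_of_le (Nat.lt_of_succ_le hk) hmono.le_apply
  have h2 : (n i : ℝ) + n k' ≤ n i' := by
    obtain ⟨m, rfl⟩ : ∃ m, i' = m + 1 := ⟨i' - 1, by omega⟩
    have h3 : (n k' : ℝ) ≤ n m := by exact_mod_cast hmono.monotone (by omega : k' ≤ m)
    have h4 : (n (i + q) : ℝ) ≤ n m := by exact_mod_cast hmono.monotone (by omega : i + q ≤ m)
    have h5 := hpow i q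
    have h6 := hdn m
    rw [div_lt_iff₀ (by linarith)] at hq
    have h7 : (n i : ℝ) ≤ (d - 1) * n m := by
      have h8 : (1 : ℝ) ≤ (d - 1) * d ^ q := by linarith
      calc (n i : ℝ) = 1 * n i := by ring
        _ ≤ ((d - 1) * d ^ q) * n i := by gcongr
        _ = (d - 1) * (d ^ q * n i) := by ring
        _ ≤ (d - 1) * n m := by
          have : 0 ≤ d - 1 := by linarith
          gcongr
          exact h5.trans h4
    linarith
  have h2' : n i + n k' ≤ n i' := by exact_mod_cast h2
  omega

/-! ### Divergent weights -/

/-- The Abel–Dini divergence: a summable sequence divided by its tails is not summable. -/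
theorem not_summable_div_tail {w : ℕ → ℝ} (hw : Summable w) (h0 : ∀ k, 0 ≤ w k)
    (hinf : ∀ k, ∃ i, k ≤ i ∧ w i ≠ 0) : ¬ Summable fun k => w k / ∑' i, w (k + (i + 1)) := by
  intro hs
  have htail : ∀ k, Summable fun i => w (k + i) := fun k => by
    simpa only [add_comm k] using (summable_nat_add_iff k).2 hw
  have hpos : ∀ k, 0 < ∑' i, w (k + i) := by
    intro k
    obtain ⟨i, hi, hne⟩ := hinf k
    refine (htail k).tsum_pos (fun i => h0 _) (i - k) ?_
    rw [Nat.add_sub_cancel' hi]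
    exact lt_of_le_of_ne (h0 i) (Ne.symm hne)
  have hr : ∀ k, (∑' i, w (k + (i + 1))) = ∑' i, w (k + 1 + i) := fun k => by
    congr 1
    ext i
    congr 1
    ring
  obtain ⟨K, hK⟩ := ((tendsto_sum_nat_add fun k => w k / ∑' i, w (k + (i + 1))).eventually
    (gt_mem_nhds one_pos)).exists
  have hle : ∀ k, w (K + k) / (∑' i, w (K + i)) ≤ w (k + K) / ∑' i, w (k + K + (i + 1)) := by
    intro k
    rw [add_comm k K]
    refine div_le_div_of_nonneg_left (h0 _) (by rw [hr]; exact hpos _) ?_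
    have h1 := (htail K).sum_add_tsum_nat_add (k + 1)
    have h2 : (∑' i, w (K + (i + (k + 1)))) = ∑' i, w (K + k + (i + 1)) := by
      congr 1
      ext i
      congr 1
      ring
    have h3 : 0 ≤ ∑ i ∈ Finset.range (k + 1), w (K + i) := Finset.sum_nonneg fun i _ => h0 _
    linarith
  have h1 := ((htail K).div_const (∑' i, w (K + i))).tsum_le_tsum hle
    ((summable_nat_add_iff K).2 hs)
  rw [tsum_div_const, div_self (hpos K).ne'] at h1
  linarith

/-- Nonsummable weights carried by points of a compact set accumulate at one of its points. -/
theorem exists_not_summable_near {E : Type*} [TopologicalSpace E] {C : Set E} (hC : IsCompact C)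
    {u : ℕ → E} {s : ℕ → ℝ} (hu : ∀ k, s k ≠ 0 → u k ∈ C) (h0 : ∀ k, 0 ≤ s k)
    (hs : ¬ Summable s) :
    ∃ x ∈ C, ∀ U ∈ nhds x, ¬ Summable ((u ⁻¹' U).indicator s) := by
  by_contra! hcon
  have hC' : Summable ((u ⁻¹' C).indicator s) := by
    refine hC.induction_on (p := fun t => Summable ((u ⁻¹' t).indicator s)) ?_ ?_ ?_ ?_
    · simp
    · intro t t' htt' h
      exact h.of_nonneg_of_le (fun k => Set.indicator_nonneg (fun k _ => h0 k) k) fun k =>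
        Set.indicator_le_indicator_of_subset (Set.preimage_mono htt') h0 k
    · intro t t' h h'
      refine (h.add h').of_nonneg_of_le
        (fun k => Set.indicator_nonneg (fun k _ => h0 k) k) fun k => ?_
      have := h0 k
      by_cases h1 : u k ∈ t <;> by_cases h2 : u k ∈ t' <;>
        simp [Set.indicator, h1, h2, this]
    · intro x hx
      obtain ⟨U, hU, hUs⟩ := hcon x hx
      exact ⟨U, mem_nhdsWithin_of_mem_nhds hU, hUs⟩
  refine hs (hC'.congr fun k => ?_)
  by_cases h : s k = 0
  · simp [Set.indicator, h]
  · simp [Set.indicator, hu k h]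

theorem exists_finset_lt_sum {s : ℕ → ℝ} (h0 : ∀ k, 0 ≤ s k) {A : Set ℕ}
    (hs : ¬ Summable (A.indicator s)) (k₀ : ℕ) (W : ℝ) :
    ∃ T : Finset ℕ, (∀ k ∈ T, k₀ ≤ k ∧ k ∈ A) ∧ W < ∑ k ∈ T, s k := by
  classical
  by_contra! hcon
  refine hs ((summable_nat_add_iff k₀).1 ?_)
  refine summable_of_sum_le (c := W) (fun k => Set.indicator_nonneg (fun k _ => h0 k) _)
    fun T => ?_
  refine le_trans (le_of_eq ?_) (hcon ((T.map (addRightEmbedding k₀)).filter (· ∈ A)) ?_)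
  · simp [Finset.sum_filter, Set.indicator]
  · intro k hk
    simp only [Finset.mem_filter, Finset.mem_map] at hk
    obtain ⟨⟨t, -, rfl⟩, hk⟩ := hk
    exact ⟨by simp, hk⟩

/-! ### Limit directions of the tails -/

section Tails

variable {X : Type*} [NormedAddCommGroup X] [InnerProductSpace ℂ X] {N : ℕ}

theorem norm_sum_sq_of_pairwise_inner_eq_zero {E ι : Type*} [NormedAddCommGroup E]
    [InnerProductSpace ℂ E] (s : Finset ι) (F : ι → E)
    (h : ∀ k ∈ s, ∀ l ∈ s, k ≠ l → inner ℂ (F k) (F l) = 0) :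
    ‖∑ k ∈ s, F k‖ ^ 2 = ∑ k ∈ s, ‖F k‖ ^ 2 := by
  classical
  induction s using Finset.induction_on with
  | empty => simp
  | insert a s ha ih =>
    rw [Finset.sum_insert ha, Finset.sum_insert ha, ← ih fun k hk l hl =>
      h k (Finset.mem_insert_of_mem hk) l (Finset.mem_insert_of_mem hl)]
    have h0 : inner ℂ (F a) (∑ k ∈ s, F k) = 0 := by
      rw [inner_sum]
      refine Finset.sum_eq_zero fun k hk => h a (Finset.mem_insert_self a s) k
        (Finset.mem_insert_of_mem hk) ?_
      rintro rfl
      exact ha hk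
    simpa only [sq] using norm_add_sq_eq_norm_sq_add_norm_sq_of_inner_eq_zero _ _ h0

/-- The tail `∑_{i ≥ k} v_i(z) z^{n_i - n_k}`, for an increasing sequence `n`. -/
noncomputable def tail (n : ℕ → ℕ) (v : ℕ → polyLE X N) (k : ℕ) : H2 X :=
  blocks (fun i => n (k + i) - n k) fun i => v (k + i)

/-- The part of the tail over the indices `i > k` with `i ≡ c` modulo `q`. -/
noncomputable def tailClass (n : ℕ → ℕ) (v : ℕ → polyLE X N) (q c k : ℕ) : H2 X :=
  blocks (fun i => n (k + (i + 1)) - n k) fun i =>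
    if (k + (i + 1)) % q = c then v (k + (i + 1)) else 0

theorem gap_sub {n : ℕ → ℕ} (hgap : ∀ i j, i < j → n i + N < n j) (k : ℕ) {e : ℕ → ℕ}
    (he : StrictMono e) :
    ∀ i j, i < j → (n (k + e i) - n k) + N < n (k + e j) - n k := by
  intro i j hij
  have h1 := hgap (k + e i) (k + e j) (by simpa using he hij)
  have h2 : n k ≤ n (k + e i) := by
    rcases Nat.eq_zero_or_pos (e i) with h | h
    · simp [h]
    · have := hgap k (k + e i) (by omega)
      omega
  omega

theorem strictMono_succ : StrictMono fun i : ℕ => i + 1 := fun _ _ h => Nat.succ_lt_succ h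

theorem summable_shifted {v : ℕ → polyLE X N} (hv : Summable fun i => ‖v i‖ ^ 2) (k : ℕ) :
    Summable fun i => ‖v (k + i)‖ ^ 2 := by
  simpa only [add_comm k] using (summable_nat_add_iff (f := fun i => ‖v i‖ ^ 2) k).2 hv

theorem summable_shifted_succ {v : ℕ → polyLE X N} (hv : Summable fun i => ‖v i‖ ^ 2) (k : ℕ) :
    Summable fun i => ‖v (k + (i + 1))‖ ^ 2 := by
  simpa only [add_comm _ 1, ← add_assoc] using summable_shifted hv (k + 1)

theorem norm_sq_class_le (v : ℕ → polyLE X N) (q c i : ℕ) :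
    ‖(if i % q = c then v i else 0)‖ ^ 2 ≤ ‖v i‖ ^ 2 := by
  split_ifs <;> simp

theorem summable_class {v : ℕ → polyLE X N} (hv : Summable fun i => ‖v i‖ ^ 2) (q c k : ℕ) :
    Summable fun i => ‖(if (k + (i + 1)) % q = c then v (k + (i + 1)) else 0)‖ ^ 2 :=
  (summable_shifted_succ hv k).of_nonneg_of_le (fun _ => by positivity)
    fun _ => norm_sq_class_le v q c _

variable [CompleteSpace X]

theorem tail_eq {n : ℕ → ℕ} (hgap : ∀ i j, i < j → n i + N < n j) {v : ℕ → polyLE X N}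
    (hv : Summable fun i => ‖v i‖ ^ 2) {q : ℕ} (hq : 0 < q) (k : ℕ) :
    tail n v k = v k + ∑ c ∈ Finset.range q, tailClass n v q c k := by
  have h1 := hasSum_blocks (gap_sub hgap k strictMono_id) (summable_shifted hv k)
  have h2 := hasSum_sum (s := Finset.range q) fun c _ =>
    hasSum_blocks (gap_sub hgap k strictMono_succ) (summable_class hv q c k)
  have h3 := (hasSum_nat_add_iff' 1).2 h1
  have h4 : ∀ i, ∑ c ∈ Finset.range q, (shift ^ (n (k + (i + 1)) - n k))
      ((if (k + (i + 1)) % q = c then v (k + (i + 1)) else 0 : polyLE X N) : H2 X)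
      = (shift ^ (n (k + (i + 1)) - n k)) (v (k + (i + 1)) : H2 X) := by
    intro i
    rw [Finset.sum_eq_single ((k + (i + 1)) % q)]
    · simp
    · intro c _ hc
      rw [if_neg (Ne.symm hc)]
      simp
    · intro hc
      exact absurd (Finset.mem_range.2 (Nat.mod_lt _ hq)) hc
  simp only [h4] at h2
  have h5 := h3.unique h2
  simp only [Finset.range_one, Finset.sum_singleton, id, add_zero, Nat.sub_self, pow_zero,
    Module.End.one_apply] at h5
  exact sub_eq_iff_eq_add'.1 h5

theorem norm_tailClass_sq_le {n : ℕ → ℕ} (hgap : ∀ i j, i < j → n i + N < n j)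
    {v : ℕ → polyLE X N} (hv : Summable fun i => ‖v i‖ ^ 2) (q c k : ℕ) :
    ‖tailClass n v q c k‖ ^ 2 ≤ ∑' i, ‖v (k + (i + 1))‖ ^ 2 := by
  rw [tailClass, norm_blocks_sq (gap_sub hgap k strictMono_succ) (summable_class hv q c k)]
  exact (summable_class hv q c k).tsum_le_tsum (fun i => norm_sq_class_le v q c _)
    (summable_shifted_succ hv k)

theorem inner_tailClass_eq_zero {n : ℕ → ℕ} (hgap : ∀ i j, i < j → n i + N < n j) {q : ℕ}
    (hsep : ∀ k i k' i', k' < i' → i + q ≤ i' → n i + n k' + N < n i' + n k)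
    {v : ℕ → polyLE X N} (hv : Summable fun i => ‖v i‖ ^ 2) (c : ℕ) {k l : ℕ} (hkl : k ≠ l) :
    inner ℂ (tailClass n v q c k) (tailClass n v q c l) = 0 := by
  have key : ∀ k i, n k ≤ n (k + (i + 1)) := fun k i =>
    (Nat.le_add_right _ _).trans (hgap k (k + (i + 1)) (by omega)).le
  refine inner_eq_zero_of_disjoint fun m => ?_
  by_contra! h
  obtain ⟨i, hi, hi1, hi2⟩ := blocks_coeff_ne_zero (gap_sub hgap k strictMono_succ)
    (summable_class hv q c k) h.1
  obtain ⟨j, hj, hj1, hj2⟩ := blocks_coeff_ne_zero (gap_sub hgap l strictMono_succ)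
    (summable_class hv q c l) h.2
  have hic : (k + (i + 1)) % q = c := by
    by_contra h
    exact hi (if_neg h)
  have hjc : (l + (j + 1)) % q = c := by
    by_contra h
    exact hj (if_neg h)
  have hk := key k i
  have hl := key l j
  have hli : l < l + (j + 1) := by omega
  have hki : k < k + (i + 1) := by omega
  generalize k + (i + 1) = a at *
  generalize l + (j + 1) = b at *
  rcases lt_trichotomy a b with hab | rfl | hab
  · have hdvd : q ∣ b - a := (Nat.modEq_iff_dvd' hab.le).1 (hic.trans hjc.symm)
    have := hsep k a l b hli (by have := Nat.le_of_dvd (by omega) hdvd; omega)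
    omega
  · rcases lt_or_gt_of_ne hkl with h | h
    · have := hgap _ _ h
      omega
    · have := hgap _ _ h
      omega
  · have hdvd : q ∣ a - b := (Nat.modEq_iff_dvd' hab.le).1 (hjc.trans hic.symm)
    have := hsep l b k a hki (by have := Nat.le_of_dvd (by omega) hdvd; omega)
    omega

/-- Within a residue class the parts of the tails are orthogonal to each other, so a linear
combination of the tails differs little from the same combination of their leading blocks. -/
theorem norm_sum_tail_sub_le {n : ℕ → ℕ} (hgap : ∀ i j, i < j → n i + N < n j) {q : ℕ}
    (hq : 0 < q) (hsep : ∀ k i k' i', k' < i' → i + q ≤ i' → n i + n k' + N < n i' + n k)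
    {v : ℕ → polyLE X N} (hv : Summable fun i => ‖v i‖ ^ 2) (T : Finset ℕ) (b : ℕ → ℂ) :
    ‖∑ k ∈ T, b k • (tail n v k - v k)‖ ≤
      q * √(∑ k ∈ T, ‖b k‖ ^ 2 * ∑' i, ‖v (k + (i + 1))‖ ^ 2) := by
  have h1 : ∑ k ∈ T, b k • (tail n v k - v k) =
      ∑ c ∈ Finset.range q, ∑ k ∈ T, b k • tailClass n v q c k := by
    rw [Finset.sum_comm]
    refine Finset.sum_congr rfl fun k _ => ?_
    rw [tail_eq hgap hv hq k, add_sub_cancel_left, Finset.smul_sum]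
  have h2 : ∀ c, ‖∑ k ∈ T, b k • tailClass n v q c k‖ ≤
      √(∑ k ∈ T, ‖b k‖ ^ 2 * ∑' i, ‖v (k + (i + 1))‖ ^ 2) := by
    intro c
    refine Real.le_sqrt_of_sq_le ?_
    rw [norm_sum_sq_of_pairwise_inner_eq_zero]
    · refine Finset.sum_le_sum fun k _ => ?_
      rw [norm_smul, mul_pow]
      gcongr
      exact norm_tailClass_sq_le hgap hv q c k
    · intro k _ l _ hkl
      rw [inner_smul_left, inner_smul_right, inner_tailClass_eq_zero hgap hsep hv c hkl]
      simp
  rw [h1]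
  refine (norm_sum_le _ _).trans ((Finset.sum_le_sum fun c _ => h2 c).trans ?_)
  simp

/-- If the directions of the nonzero blocks stay in a compact set, one of the points of that set
is a limit of linear combinations of arbitrarily late tails. -/
theorem exists_mem_closure_span_tail {n : ℕ → ℕ} (hgap : ∀ i j, i < j → n i + N < n j) {q : ℕ}
    (hq : 0 < q) (hsep : ∀ k i k' i', k' < i' → i + q ≤ i' → n i + n k' + N < n i' + n k)
    {v : ℕ → polyLE X N} (hv : Summable fun i => ‖v i‖ ^ 2)
    (hinf : ∀ k, ∃ i, k ≤ i ∧ v i ≠ 0) {C : Set (polyLE X N)} (hC : IsCompact C)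
    (hvC : ∀ k, v k ≠ 0 → ((‖v k‖⁻¹ : ℝ) : ℂ) • v k ∈ C) :
    ∃ u ∈ C, ∀ k₀,
      (u : H2 X) ∈ closure (Submodule.span ℂ (tail n v '' Set.Ici k₀) : Set (H2 X)) := by
  set r : ℕ → ℝ := fun k => ∑' i, ‖v (k + (i + 1))‖ ^ 2 with hr
  set s : ℕ → ℝ := fun k => ‖v k‖ ^ 2 / r k with hs
  have hrpos : ∀ k, 0 < r k := by
    intro k
    obtain ⟨i, hi, hne⟩ := hinf (k + 1)
    refine (summable_shifted_succ hv k).tsum_pos (fun i => by positivity) (i - (k + 1)) ?_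
    have : k + (i - (k + 1) + 1) = i := by omega
    rw [this]
    positivity
  have hs0 : ∀ k, 0 ≤ s k := fun k => div_nonneg (by positivity) (hrpos k).le
  have hsn : ¬ Summable s := not_summable_div_tail hv (fun k => by positivity) fun k => by
    obtain ⟨i, hi, hne⟩ := hinf k
    exact ⟨i, hi, by positivity⟩
  obtain ⟨u, huC, hu⟩ := exists_not_summable_near hC
    (u := fun k => ((‖v k‖⁻¹ : ℝ) : ℂ) • v k) (s := s)
    (fun k hk => hvC k fun h => hk (by simp [hs, h]))
    hs0 hsn
  refine ⟨u, huC, fun k₀ => Metric.mem_closure_iff.2 fun ε hε => ?_⟩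
  obtain ⟨T, hT, hW⟩ := exists_finset_lt_sum hs0 (hu _ (Metric.ball_mem_nhds u (half_pos hε))) k₀
    ((2 * q / ε) ^ 2)
  set W := ∑ k ∈ T, s k with hWdef
  have hWpos : 0 < W := lt_of_le_of_lt (by positivity) hW
  -- these weights minimize the bound for the remainder subject to `∑ b k * ‖v k‖ = 1`
  set b : ℕ → ℝ := fun k => ‖v k‖ / r k / W with hb
  have hb1 : ∀ k, b k * ‖v k‖ = s k / W := fun k => by
    simp only [hb, hs]
    ring
  refine ⟨∑ k ∈ T, (b k : ℂ) • tail n v k, Submodule.sum_mem _ fun k hk =>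
    Submodule.smul_mem _ _ (Submodule.subset_span ⟨k, (hT k hk).1, rfl⟩), ?_⟩
  have hrem : ‖∑ k ∈ T, (b k : ℂ) • (tail n v k - v k)‖ < ε / 2 := by
    refine (norm_sum_tail_sub_le hgap hq hsep hv T _).trans_lt ?_
    have h1 : ∑ k ∈ T, ‖(b k : ℂ)‖ ^ 2 * ∑' i, ‖v (k + (i + 1))‖ ^ 2 = W⁻¹ := by
      have h2 : ∀ k ∈ T, ‖(b k : ℂ)‖ ^ 2 * ∑' i, ‖v (k + (i + 1))‖ ^ 2 = s k / W ^ 2 := by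
        intro k _
        have := (hrpos k).ne'
        rw [Complex.norm_real, Real.norm_eq_abs, sq_abs]
        change b k ^ 2 * r k = s k / W ^ 2
        simp only [hb, hs]
        field_simp
      rw [Finset.sum_congr rfl h2, ← Finset.sum_div, ← hWdef, sq,
        div_mul_cancel_left₀ hWpos.ne']
    rw [h1]
    have h3 : √W⁻¹ < ε / (2 * q) := by
      have hq' : (0 : ℝ) < q := by exact_mod_cast hq
      rw [Real.sqrt_lt' (by positivity), inv_lt_comm₀ hWpos (by positivity),
        ← inv_pow, inv_div]
      exact hW
    have hq' : (0 : ℝ) < q := by exact_mod_cast hq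
    calc (q : ℝ) * √W⁻¹ < q * (ε / (2 * q)) := by gcongr
      _ = ε / 2 := by field_simp
  have hlead : ‖∑ k ∈ T, (b k : ℂ) • v k - u‖ ≤ ε / 2 := by
    have h1 : ∑ k ∈ T, (b k : ℂ) • v k - u =
        ∑ k ∈ T, ((s k / W : ℝ) : ℂ) • (((‖v k‖⁻¹ : ℝ) : ℂ) • v k - u) := by
      have h2 : ∑ k ∈ T, ((s k / W : ℝ) : ℂ) • u = u := by
        rw [← Finset.sum_smul, ← Complex.ofReal_sum, ← Finset.sum_div, ← hWdef,
          div_self hWpos.ne']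
        simp
      simp only [smul_sub, Finset.sum_sub_distrib, h2]
      congr 1
      refine Finset.sum_congr rfl fun k _ => ?_
      by_cases h : v k = 0
      · simp [h]
      · rw [smul_smul, ← Complex.ofReal_mul, ← hb1, mul_assoc,
          mul_inv_cancel₀ (norm_ne_zero_iff.2 h), mul_one]
    rw [h1]
    refine (norm_sum_le _ _).trans ?_
    calc ∑ k ∈ T, ‖((s k / W : ℝ) : ℂ) • (((‖v k‖⁻¹ : ℝ) : ℂ) • v k - u)‖
        ≤ ∑ k ∈ T, s k / W * (ε / 2) := by
          refine Finset.sum_le_sum fun k hk => ?_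
          have h3 := (hT k hk).2
          rw [Set.mem_preimage, mem_ball_iff_norm] at h3
          rw [norm_smul, Complex.norm_real, Real.norm_of_nonneg (div_nonneg (hs0 k) hWpos.le)]
          have := div_nonneg (hs0 k) hWpos.le
          gcongr
      _ = ε / 2 := by
          rw [← Finset.sum_mul, ← Finset.sum_div, ← hWdef, div_self hWpos.ne', one_mul]
  have hsplit : (u : H2 X) - ∑ k ∈ T, (b k : ℂ) • tail n v k =
      -((∑ k ∈ T, (b k : ℂ) • v k - u : polyLE X N) : H2 X)
        - ∑ k ∈ T, (b k : ℂ) • (tail n v k - v k) := by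
    simp only [smul_sub, Finset.sum_sub_distrib, Submodule.coe_sub, Submodule.coe_sum,
      Submodule.coe_smul]
    abel
  rw [dist_eq_norm, hsplit]
  refine (norm_sub_le _ _).trans_lt ?_
  rw [norm_neg]
  have h4 : ‖((∑ k ∈ T, (b k : ℂ) • v k - u : polyLE X N) : H2 X)‖ ≤ ε / 2 := hlead
  linarith

end Tails

/-! ### The subspaces `H² ⊗ L` -/

section Product

variable {X : Type*} [NormedAddCommGroup X] [InnerProductSpace ℂ X] {N : ℕ}

theorem memlp_smul_const (h : H2 ℂ) (x : X) :
    Memℓp (E := fun _ : ℕ => X) (fun m => (h : ℕ → ℂ) m • x) 2 := by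
  rw [memlp_two_iff]
  simp only [norm_smul, mul_pow]
  exact (hasSum_norm_sq_coeff h).summable.mul_right _

/-- The operator `h ↦ h x` of multiplication by a constant vector, from `H²` to `H²(𝔻, X)`. -/
noncomputable def mulConst (x : X) : H2 ℂ →L[ℂ] H2 X :=
  LinearMap.mkContinuous
    { toFun := fun h => ⟨fun m => (h : ℕ → ℂ) m • x, memlp_smul_const h x⟩
      map_add' := fun h k => by
        ext m
        exact add_smul _ _ _
      map_smul' := fun c h => by
        ext m
        exact mul_smul _ _ _ }
    ‖x‖ fun h => by
      rw [← sq_le_sq₀ (norm_nonneg _) (by positivity)]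
      refine le_of_eq ((hasSum_norm_sq_coeff _).unique ?_)
      rw [mul_pow]
      refine ((hasSum_norm_sq_coeff h).mul_left (‖x‖ ^ 2)).congr_fun fun m => ?_
      change ‖(h : ℕ → ℂ) m • x‖ ^ 2 = _
      rw [norm_smul, mul_pow, mul_comm]

/-- The operator `h ↦ h p` of multiplication by the polynomial `∑_{s ≤ N} p_s z^s`, from `H²` to
`H²(𝔻, X)`. -/
noncomputable def mulPoly (N : ℕ) (p : H2 X) : H2 ℂ →L[ℂ] H2 X :=
  ∑ s ∈ Finset.range (N + 1),
    (shiftIsometry s).toContinuousLinearMap.comp (mulConst ((p : ℕ → X) s))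

theorem mulPoly_coeff (p : H2 X) (h : H2 ℂ) (m : ℕ) :
    (mulPoly N p h : ℕ → X) m = ∑ s ∈ Finset.range (N + 1),
      if s ≤ m then (h : ℕ → ℂ) (m - s) • (p : ℕ → X) s else 0 := by
  rw [mulPoly, sum_apply, sum_coeff]
  exact Finset.sum_congr rfl fun s _ => shift_pow_coeff s _ m

theorem isProduct_iff {p : H2 X} (hp : p ∈ polyLE X N) (h : H2 ℂ) (u : H2 X) :
    IsProduct h p u ↔ u = mulPoly N p h := by
  have key : ∀ m, ∑ ij ∈ Finset.HasAntidiagonal.antidiagonal m,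
      (h : ℕ → ℂ) ij.1 • (p : ℕ → X) ij.2 = (mulPoly N p h : ℕ → X) m := by
    intro m
    rw [mulPoly_coeff, ← Finset.Nat.sum_antidiagonal_swap]
    refine (Finset.Nat.sum_antidiagonal_eq_sum_range_succ
      (fun i j => (h : ℕ → ℂ) j • (p : ℕ → X) i) m).trans ?_
    trans ∑ s ∈ Finset.range (m + N + 1),
      if s ≤ m then (h : ℕ → ℂ) (m - s) • (p : ℕ → X) s else 0
    · rw [← Finset.sum_subset (Finset.range_mono (by omega : m + 1 ≤ m + N + 1))]
      · refine Finset.sum_congr rfl fun s hs => (if_pos ?_).symm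
        simpa [Nat.lt_succ_iff] using hs
      · intro s _ hs
        exact if_neg fun h => hs (by simpa [Nat.lt_succ_iff] using h)
    · symm
      refine Finset.sum_subset (Finset.range_mono (by omega)) fun s _ hs => ?_
      rw [hp s (by simpa using hs)]
      simp
  constructor
  · intro hu
    ext m
    rw [hu m, key]
  · rintro rfl m
    exact (key m).symm

theorem isProduct_single (j : ℕ) (c : ℂ) (p : H2 X) :
    IsProduct (lp.single 2 j c) p (c • (shift ^ j) p) := by
  intro m
  rw [lp.coeFn_smul, Pi.smul_apply, shift_pow_coeff]
  split_ifs with h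
  · rw [Finset.sum_eq_single (j, m - j)]
    · simp
    · rintro ⟨a, b⟩ hab hne
      have ha : a ≠ j := by
        rintro rfl
        rw [Finset.HasAntidiagonal.mem_antidiagonal] at hab
        exact hne (by rw [← hab]; simp)
      simp [lp.single_apply, ha]
    · intro hne
      exact absurd (Finset.HasAntidiagonal.mem_antidiagonal.2 (by omega)) hne
  · rw [smul_zero, eq_comm]
    refine Finset.sum_eq_zero fun ij hij => ?_
    rw [Finset.HasAntidiagonal.mem_antidiagonal] at hij
    have ha : ij.1 ≠ j := by omega
    simp [lp.single_apply, ha]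

/-- A polynomial `p` satisfies `H² p ⊆ E`, for a closed subspace `E`, as soon as `z^j p ∈ E` for
all `j`. -/
theorem tensor_le {L E : Submodule ℂ (H2 X)} (hE : IsClosed (E : Set (H2 X))) (hL : L ≤ polyLE X N)
    (h : ∀ p ∈ L, ∀ j, (shift ^ j) p ∈ E) : tensor L ≤ E := by
  refine Submodule.topologicalClosure_minimal _ (Submodule.span_le.2 ?_) hE
  rintro u ⟨g, p, hp, hu⟩
  rw [isProduct_iff (hL hp)] at hu
  subst hu
  have h1 := (lp.hasSum_single (p := 2) (by norm_num) g).mapL (mulPoly N p)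
  refine hE.mem_of_tendsto h1 (Filter.Eventually.of_forall fun s =>
    Submodule.sum_mem _ fun j _ => ?_)
  rw [← (isProduct_iff (hL hp) _ _).1 (isProduct_single j ((g : ℕ → ℂ) j) p)]
  exact Submodule.smul_mem _ _ (h p hp j)

theorem shift_pow_mem_tensor {L : Submodule ℂ (H2 X)} {p : H2 X} (hp : p ∈ L) (j : ℕ) :
    (shift ^ j) p ∈ tensor L :=
  Submodule.le_topologicalClosure _ (Submodule.subset_span
    ⟨lp.single 2 j 1, p, hp, by simpa using isProduct_single j 1 p⟩)

theorem le_tensor (L : Submodule ℂ (H2 X)) : L ≤ tensor L := fun _ hp =>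
  by simpa using shift_pow_mem_tensor hp 0

theorem isClosed_tensor (L : Submodule ℂ (H2 X)) : IsClosed (tensor L : Set (H2 X)) :=
  Submodule.isClosed_topologicalClosure _

theorem blocks_mem_tensor [CompleteSpace X] {L : Submodule ℂ (H2 X)} {e : ℕ → ℕ}
    (he : ∀ i j, i < j → e i + N < e j) {v : ℕ → polyLE X N}
    (hv : Summable fun i => ‖v i‖ ^ 2) (hvL : ∀ i, (v i : H2 X) ∈ L) : blocks e v ∈ tensor L :=
  (isClosed_tensor L).mem_of_tendsto (hasSum_blocks he hv)
    (Filter.Eventually.of_forall fun _ => Submodule.sum_mem _ fun i _ =>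
      shift_pow_mem_tensor (hvL i) _)

end Product

/-! ### Cyclic subspaces and the maximal block space -/

section Orbit

variable {X : Type*} [NormedAddCommGroup X] [InnerProductSpace ℂ X] {N : ℕ}

theorem isClosed_orbitSpan (f : H2 X) : IsClosed (orbitSpan f : Set (H2 X)) :=
  Submodule.isClosed_topologicalClosure _

theorem backwardShift_pow_mem_orbitSpan (f : H2 X) (k : ℕ) :
    (backwardShift ^ k) f ∈ orbitSpan f :=
  Submodule.le_topologicalClosure _ (Submodule.subset_span ⟨k, rfl⟩)

theorem orbitSpan_le {f : H2 X} {E : Submodule ℂ (H2 X)} (hE : IsClosed (E : Set (H2 X)))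
    (h : ∀ k, (backwardShift ^ k) f ∈ E) : orbitSpan f ≤ E := by
  refine Submodule.topologicalClosure_minimal _ (Submodule.span_le.2 ?_) hE
  rintro _ ⟨k, rfl⟩
  exact h k

theorem orbitSpan_backwardShift_pow_le (f : H2 X) (k : ℕ) :
    orbitSpan ((backwardShift ^ k) f) ≤ orbitSpan f :=
  orbitSpan_le (isClosed_orbitSpan f) fun m => by
    rw [← Module.End.mul_apply, ← pow_add]
    exact backwardShift_pow_mem_orbitSpan f _

theorem backwardShift_pow_mem_orbitSpan_of_mem {f g : H2 X} (hg : g ∈ orbitSpan f) (k : ℕ) :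
    (backwardShift ^ k) g ∈ orbitSpan ((backwardShift ^ k) f) := by
  have h : orbitSpan f ≤ (orbitSpan ((backwardShift ^ k) f)).comap (backwardShift ^ k) := by
    refine orbitSpan_le ((isClosed_orbitSpan _).preimage (continuous_backwardShift_pow k))
      fun m => ?_
    rw [Submodule.mem_comap, ← Module.End.mul_apply, ← pow_add, add_comm, pow_add,
      Module.End.mul_apply]
    exact backwardShift_pow_mem_orbitSpan _ m
  exact h hg

theorem map_orbitSpan_topologicalClosure (f : H2 X) (k : ℕ) :
    ((orbitSpan f).map (backwardShift ^ k)).topologicalClosure =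
      orbitSpan ((backwardShift ^ k) f) := by
  refine le_antisymm (Submodule.topologicalClosure_minimal _ ?_ (isClosed_orbitSpan _))
    (orbitSpan_le (Submodule.isClosed_topologicalClosure _) fun m => ?_)
  · rintro _ ⟨g, hg, rfl⟩
    exact backwardShift_pow_mem_orbitSpan_of_mem hg k
  · refine Submodule.le_topologicalClosure _ ⟨(backwardShift ^ m) f,
      backwardShift_pow_mem_orbitSpan f m, ?_⟩
    rw [← Module.End.mul_apply, ← Module.End.mul_apply, ← pow_add, ← pow_add, add_comm]

/-- The polynomials `p` of degree at most `N` with `z^j p ∈ E_f` for all `j`. -/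
noncomputable def blockSpace (f : H2 X) (N : ℕ) : Submodule ℂ (H2 X) :=
  polyLE X N ⊓ ⨅ j : ℕ, (orbitSpan f).comap (shift ^ j)

theorem mem_blockSpace {f p : H2 X} :
    p ∈ blockSpace f N ↔ p ∈ polyLE X N ∧ ∀ j, (shift ^ j) p ∈ orbitSpan f := by
  simp [blockSpace]

theorem isMaximalBlockSpace_blockSpace (f : H2 X) (N : ℕ) :
    IsMaximalBlockSpace f N (blockSpace f N) where
  le_polyLE := inf_le_left
  isClosed := by
    have : (blockSpace f N : Set (H2 X)) =
        (polyLE X N : Set (H2 X)) ∩ ⋂ j : ℕ, (shift ^ j : H2 X →ₗ[ℂ] H2 X) ⁻¹' (orbitSpan f) := by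
      ext p
      simp [mem_blockSpace]
    rw [this]
    exact (isClosed_polyLE N).inter
      (isClosed_iInter fun j => (isClosed_orbitSpan f).preimage (continuous_shift_pow j))
  tensor_le := by
    refine le_iInf fun k => tensor_le (isClosed_orbitSpan _) inf_le_left fun p hp j => ?_
    rw [← backwardShift_pow_add_shift_pow k j]
    exact backwardShift_pow_mem_orbitSpan_of_mem ((mem_blockSpace.1 hp).2 _) k
  maximal := by
    intro g hg h
    exact mem_blockSpace.2
      ⟨hg, fun j => h (shift_pow_mem_tensor (Submodule.mem_span_singleton_self g) j)⟩

theorem IsMaximalBlockSpace.tensor_le_orbitSpan {f : H2 X} {L : Submodule ℂ (H2 X)}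
    (hL : IsMaximalBlockSpace f N L) : tensor L ≤ orbitSpan f :=
  hL.tensor_le.trans (iInf_le_of_le 0 (by simp))

theorem IsMaximalBlockSpace.eq_blockSpace {f : H2 X} {L : Submodule ℂ (H2 X)}
    (hL : IsMaximalBlockSpace f N L) : L = blockSpace f N := by
  refine le_antisymm (fun p hp => mem_blockSpace.2 ⟨hL.le_polyLE hp, fun j =>
    hL.tensor_le_orbitSpan (shift_pow_mem_tensor hp j)⟩) fun p hp => ?_
  rw [mem_blockSpace] at hp
  refine hL.maximal p hp.1 (Hardy.tensor_le (N := N) (isClosed_orbitSpan f)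
    ((Submodule.span_singleton_le_iff_mem _ _).2 hp.1) fun q hq j => ?_)
  obtain ⟨c, rfl⟩ := Submodule.mem_span_singleton.1 hq
  rw [map_smul]
  exact Submodule.smul_mem _ _ (hp.2 j)

theorem map_shift_tensor_le {L : Submodule ℂ (H2 X)} (hL : L ≤ polyLE X N) :
    (tensor L).map shift ≤ tensor L := by
  rw [Submodule.map_le_iff_le_comap]
  refine tensor_le ?_ hL fun p hp j => ?_
  · exact (isClosed_tensor L).preimage (by simpa using continuous_shift_pow (X := X) 1)
  · rw [Submodule.mem_comap, ← Module.End.mul_apply, ← pow_succ']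
    exact shift_pow_mem_tensor hp _

end Orbit

/-! ### The blocks of a lacunary series eventually lie in the block space -/

section Main

variable {X : Type*} [NormedAddCommGroup X] [InnerProductSpace ℂ X] {N : ℕ}

theorem hasSum_backwardShift {f : H2 X} {n : ℕ → ℕ} {P : ℕ → polyLE X N}
    (hf : IsBlockSeries f n P) {a k : ℕ} (hlt : ∀ i < k, n i + N < a) (hle : ∀ i, k ≤ i → a ≤ n i)
    (m : ℕ) : HasSum (fun i => ((shift ^ (n (k + i) - a)) (P (k + i) : H2 X) : ℕ → X) m)
      (((backwardShift ^ a) f : ℕ → X) m) := by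
  have h := (hasSum_nat_add_iff' k).2 (hf (m + a))
  rw [Finset.sum_eq_zero, sub_zero, ← backwardShift_pow_coeff] at h
  · refine h.congr_fun fun i => ?_
    have h1 := hle (k + i) (Nat.le_add_right _ _)
    rw [add_comm i k, shift_pow_coeff, shift_pow_coeff]
    by_cases h2 : n (k + i) ≤ m + a
    · rw [if_pos h2, if_pos (by omega),
        (by omega : m + a - n (k + i) = m - (n (k + i) - a))]
    · rw [if_neg h2, if_neg (by omega)]
  · intro i hi
    by_contra hne
    have h1 := shift_pow_coeff_ne_zero (P i).2 hne
    have h2 := hlt i (Finset.mem_range.1 hi)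
    omega

theorem tail_add [CompleteSpace X] {n : ℕ → ℕ} (hgap : ∀ i j, i < j → n i + N < n j)
    {v w : ℕ → polyLE X N} (hv : Summable fun i => ‖v i‖ ^ 2) (hw : Summable fun i => ‖w i‖ ^ 2)
    (k : ℕ) (hvw : Summable fun i => ‖v i + w i‖ ^ 2) :
    tail n (fun i => v i + w i) k = tail n v k + tail n w k := by
  have hg := gap_sub hgap k strictMono_id
  refine (hasSum_blocks hg (summable_shifted hvw k)).unique ?_
  refine ((hasSum_blocks hg (summable_shifted hv k)).add
    (hasSum_blocks hg (summable_shifted hw k))).congr_fun fun i => ?_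
  simp

variable [CompleteSpace X]

theorem shift_pow_tail_eq {f : H2 X} {n : ℕ → ℕ} {P : ℕ → polyLE X N} {K : ℕ}
    (hmono : StrictMono n) (hf : IsBlockSeries f n P)
    (hgap : ∀ i j, i < j → n (K + i) + N < n (K + j))
    (hP : Summable fun i => ‖P (K + i)‖ ^ 2) {j k : ℕ}
    (hlt : ∀ i < K + k, n i + (N + j) < n (K + k)) (hj : j ≤ n (K + k)) :
    (shift ^ j) (tail (fun i => n (K + i)) (fun i => P (K + i)) k) =
      (backwardShift ^ (n (K + k) - j)) f := by
  have h1 : HasSum _ _ := (hasSum_blocks (gap_sub hgap k strictMono_id)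
    (summable_shifted hP k)).mapL (shiftIsometry j).toContinuousLinearMap
  ext m
  refine (hasSum_coeff h1 m).unique ?_
  refine (hasSum_backwardShift hf (a := n (K + k) - j) (k := K + k) (fun i hi => ?_)
    (fun i hi => ?_) m).congr_fun fun i => ?_
  · have := hlt i hi
    omega
  · have := hmono.monotone hi
    omega
  · have h2 : n (K + k) ≤ n (K + k + i) := hmono.monotone (Nat.le_add_right _ _)
    have h3 : n (K + k + i) - (n (K + k) - j) = j + (n (K + (k + id i)) - n (K + k)) := by
      rw [id, ← add_assoc]
      omega
    rw [h3, pow_add, Module.End.mul_apply, add_assoc]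
    rfl

/-- All late blocks `P_k` satisfy `H² P_k ⊆ E_f`. Otherwise the components of the `P_k` orthogonal
to the block space do not vanish eventually; by complete relative compactness one of their limit
directions `u` is approximated by their tails, whose shifts differ from elements of `E_f` by
elements of `E_f`. Then `u` lies in the block space, and is orthogonal to it. -/
theorem exists_forall_mem_blockSpace {f : H2 X} {n : ℕ → ℕ} {P : ℕ → polyLE X N}
    (hn : IsLacunary n) (hP : IsCRC P) (hf : IsBlockSeries f n P) :
    ∃ K, ∀ k, K ≤ k → (P k : H2 X) ∈ blockSpace f N := by
  obtain ⟨K₁, hK₁⟩ := hn.exists_gap N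
  obtain ⟨K₂, q, hq, hK₂⟩ := hn.exists_separation N
  set K := max K₁ K₂ + 1 with hK
  have hgap : ∀ i j, i < j → n (K + i) + N < n (K + j) := fun i j hij =>
    hK₁ _ _ (by omega) (by omega)
  have hsep : ∀ k i k' i', k' < i' → i + q ≤ i' →
      n (K + i) + n (K + k') + N < n (K + i') + n (K + k) := fun k i k' i' h h' =>
    hK₂ _ _ _ _ (by omega) (by omega) (by omega)
  have hPs : Summable fun i => ‖P (K + i)‖ ^ 2 := by
    refine summable_norm_sq_of_blocks (e := fun i => n (K + i) - n K) (fun i j hij => ?_)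
      (hasSum_backwardShift hf (fun i hi => ?_) fun i hi => hn.1.monotone hi)
    · have h1 := hgap i j hij
      have h2 : n K ≤ n (K + i) := hn.1.monotone (Nat.le_add_right _ _)
      omega
    · rcases le_or_gt K₁ i with h | h
      · exact hK₁ _ _ h hi
      · have h1 := hK₁ K₁ K le_rfl (by omega)
        have h2 := hn.1 h
        omega
  have : CompleteSpace (polyLE X N) := (isClosed_polyLE N).completeSpace_coe
  set L : Submodule ℂ (polyLE X N) := (blockSpace f N).comap (polyLE X N).subtype with hL
  have hLc : IsClosed (L : Set (polyLE X N)) :=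
    (isMaximalBlockSpace_blockSpace f N).isClosed.preimage continuous_subtype_val
  have : CompleteSpace L := hLc.completeSpace_coe
  set v : ℕ → polyLE X N := fun i => Lᗮ.starProjection (P (K + i)) with hv
  set w : ℕ → polyLE X N := fun i => L.starProjection (P (K + i)) with hw
  have hvw : ∀ i, v i + w i = P (K + i) := fun i => by
    rw [add_comm]
    exact Submodule.starProjection_add_starProjection_orthogonal _
  have hwL : ∀ i, (w i : H2 X) ∈ blockSpace f N := fun i =>
    (Submodule.starProjection_apply_mem L (P (K + i)) : w i ∈ L)
  have hvs : Summable fun i => ‖v i‖ ^ 2 := hPs.of_nonneg_of_le (fun i => by positivity) fun i => by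
    gcongr
    exact Submodule.norm_starProjection_apply_le _ _
  have hws : Summable fun i => ‖w i‖ ^ 2 := hPs.of_nonneg_of_le (fun i => by positivity) fun i => by
    gcongr
    exact Submodule.norm_starProjection_apply_le _ _
  by_contra! hcon
  have hinf : ∀ k, ∃ i, k ≤ i ∧ v i ≠ 0 := by
    intro k
    obtain ⟨i, hi, hne⟩ := hcon (K + k)
    refine ⟨i - K, by omega, fun h0 => hne ?_⟩
    have h1 := hvw (i - K)
    rw [h0, zero_add, Nat.add_sub_cancel' (by omega)] at h1
    rw [← h1]
    exact hwL _
  set D : Set (polyLE X N) := {x | ∃ k, Lᗮ.starProjection (P k) ≠ 0 ∧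
      x = ((‖Lᗮ.starProjection (P k)‖⁻¹ : ℝ) : ℂ) • Lᗮ.starProjection (P k)} with hD
  obtain ⟨u, huD, hu⟩ := exists_mem_closure_span_tail (n := fun i => n (K + i)) hgap hq hsep
    hvs hinf (hP Lᗮ) fun k hk => subset_closure ⟨K + k, hk, rfl⟩
  have hDsub : closure D ⊆ Lᗮ ∩ Metric.sphere 0 1 := by
    refine closure_minimal ?_ (L.isClosed_orthogonal.inter Metric.isClosed_sphere)
    rintro _ ⟨k, hk, rfl⟩
    refine ⟨Submodule.smul_mem _ _ (Submodule.starProjection_apply_mem _ _), ?_⟩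
    rw [mem_sphere_zero_iff_norm, norm_smul, Complex.norm_real, norm_inv, norm_norm,
      inv_mul_cancel₀ (norm_ne_zero_iff.2 hk)]
  obtain ⟨hu1, hu2⟩ := hDsub huD
  have huL : u ∈ L := by
    refine mem_blockSpace.2 ⟨u.2, fun j => ?_⟩
    obtain ⟨k₀, hk₀⟩ := hn.exists_gap (N + j)
    have hcl : IsClosed ((orbitSpan f).comap (shift ^ j) : Set (H2 X)) :=
      (isClosed_orbitSpan f).preimage (continuous_shift_pow j)
    refine closure_minimal (Submodule.span_le.2 ?_) hcl (hu (k₀ + 1))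
    rintro _ ⟨k, hk, rfl⟩
    rw [Set.mem_Ici] at hk
    have h1 : tail (fun i => n (K + i)) v k = tail (fun i => n (K + i)) (fun i => P (K + i)) k
        - tail (fun i => n (K + i)) w k := by
      rw [eq_sub_iff_add_eq, ← tail_add hgap hvs hws k (by simpa only [hvw] using hPs)]
      simp only [hvw]
    have h2 : ∀ i < K + k, n i + (N + j) < n (K + k) := by
      intro i hi
      rcases le_or_gt k₀ i with h | h
      · exact hk₀ _ _ h hi
      · have h3 := hk₀ k₀ (K + k) le_rfl (by omega)
        have h4 := hn.1 h
        omega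
    rw [SetLike.mem_coe, Submodule.mem_comap, h1, map_sub]
    refine Submodule.sub_mem _ ?_ ?_
    · rw [shift_pow_tail_eq hn.1 hf hgap hPs h2 (by have := h2 0 (by omega); omega)]
      exact backwardShift_pow_mem_orbitSpan f _
    · have h5 : tail (fun i => n (K + i)) w k ∈ tensor (blockSpace f N) :=
        blocks_mem_tensor (gap_sub (n := fun i => n (K + i)) hgap k strictMono_id)
          (summable_shifted hws k) fun i => hwL _
      have h6 : tensor (blockSpace f N) ≤ (orbitSpan f).comap (shift ^ j) :=
        tensor_le hcl inf_le_left fun p hp i => by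
          rw [Submodule.mem_comap, ← Module.End.mul_apply, ← pow_add]
          exact (mem_blockSpace.1 hp).2 _
      exact h6 h5
  have hu0 : u = 0 := by
    have := Submodule.inner_right_of_mem_orthogonal huL hu1
    exact inner_self_eq_zero.1 this
  simp [hu0] at hu2

/-- Up to a polynomial, the series is an element of `H² ⊗ L`. -/
theorem exists_eq_add_polynomial {f : H2 X} {n : ℕ → ℕ} {P : ℕ → polyLE X N}
    (hn : IsLacunary n) (hP : IsCRC P) (hf : IsBlockSeries f n P) :
    ∃ g ∈ tensor (blockSpace f N), ∃ p : H2 X, (∃ M : ℕ, p ∈ polyLE X M) ∧ f = g + p := by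
  obtain ⟨K₁, hK₁⟩ := exists_forall_mem_blockSpace hn hP hf
  obtain ⟨K₂, hK₂⟩ := hn.exists_gap N
  set K := max K₁ K₂ + 1 with hK
  have hgap : ∀ i j, i < j → n (K + i) + N < n (K + j) := fun i j hij =>
    hK₂ _ _ (by omega) (by omega)
  have hlt : ∀ i < K, n i + N < n K := by
    intro i hi
    rcases le_or_gt K₂ i with h | h
    · exact hK₂ _ _ h hi
    · have h1 := hK₂ K₂ K le_rfl (by omega)
      have h2 := hn.1 h
      omega
  have hgap' : ∀ i j, i < j → (n (K + i) - n K) + N < n (K + j) - n K := fun i j hij => by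
    have h1 := hgap i j hij
    have h2 : n K ≤ n (K + i) := hn.1.monotone (Nat.le_add_right _ _)
    omega
  have hsum := hasSum_backwardShift hf (a := n K) (k := K) hlt fun i hi => hn.1.monotone hi
  have hPs : Summable fun i => ‖P (K + i)‖ ^ 2 := summable_norm_sq_of_blocks hgap' hsum
  have heq := eq_blocks hgap' hPs hsum
  set g := blocks (fun i => n (K + i)) fun i => P (K + i) with hg
  have hgm : g ∈ tensor (blockSpace f N) := blocks_mem_tensor hgap hPs fun i => hK₁ _ (by omega)
  refine ⟨g, hgm, f - g, ⟨n K + N, fun m hm => ?_⟩, by simp⟩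
  have hg' := hasSum_coeff (hasSum_blocks hgap hPs) m
  have hf' := (hasSum_nat_add_iff' K).2 (hf m)
  rw [Finset.sum_eq_zero, sub_zero] at hf'
  · simp only [add_comm _ K] at hf'
    rw [lp.coeFn_sub, Pi.sub_apply, hf'.unique hg', sub_self]
  · intro i hi
    by_contra hne
    have h1 := shift_pow_coeff_ne_zero (P i).2 hne
    have h2 := hlt i (Finset.mem_range.1 hi)
    omega

end Main

/-! ### The intersection of the cyclic subspaces -/

section BlockSum

variable {X : Type*} [NormedAddCommGroup X] [InnerProductSpace ℂ X] {N : ℕ}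

theorem isClosed_blockSum (N : ℕ) (L : Submodule ℂ (H2 X)) :
    IsClosed (blockSum N L : Set (H2 X)) :=
  Submodule.isClosed_topologicalClosure _

theorem tensor_le_blockSum (N : ℕ) (L : Submodule ℂ (H2 X)) : tensor L ≤ blockSum N L :=
  le_sup_left.trans (Submodule.le_topologicalClosure _)

theorem blockSum_le {L E : Submodule ℂ (H2 X)} (hE : IsClosed (E : Set (H2 X)))
    (hL : L ≤ polyLE X N) (h1 : ∀ p ∈ L, ∀ j, (shift ^ j) p ∈ E)
    (h2 : ∀ p ∈ L, ∀ i, (backwardShift ^ i) p ∈ E) : blockSum N L ≤ E := by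
  refine Submodule.topologicalClosure_minimal _ (sup_le (tensor_le hE hL h1)
    (iSup₂_le fun i _ => ?_)) hE
  rintro _ ⟨p, hp, rfl⟩
  exact h2 p hp i

theorem backwardShift_pow_mem_blockSum {L : Submodule ℂ (H2 X)} (hL : L ≤ polyLE X N) {p : H2 X}
    (hp : p ∈ L) (i : ℕ) : (backwardShift ^ i) p ∈ blockSum N L := by
  rcases Nat.eq_zero_or_pos i with rfl | hi
  · exact tensor_le_blockSum N L (by simpa using le_tensor L hp)
  rcases le_or_gt i N with hN | hN
  · refine Submodule.le_topologicalClosure _ (Submodule.mem_sup_right ?_)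
    exact Submodule.mem_iSup_of_mem i (Submodule.mem_iSup_of_mem (Finset.mem_Icc.2 ⟨hi, hN⟩)
      ⟨p, hp, rfl⟩)
  · have h0 : (backwardShift ^ i) p = 0 := by
      ext m
      rw [backwardShift_pow_coeff, hL hp _ (by omega)]
      rfl
    rw [h0]
    exact Submodule.zero_mem _

theorem backwardShift_mem_blockSum {L : Submodule ℂ (H2 X)} (hL : L ≤ polyLE X N) {g : H2 X}
    (hg : g ∈ blockSum N L) : backwardShift g ∈ blockSum N L := by
  have h : blockSum N L ≤ (blockSum N L).comap backwardShift := by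
    refine blockSum_le ?_ hL (fun p hp j => ?_) fun p hp i => ?_
    · exact (isClosed_blockSum N L).preimage
        (by simpa using continuous_backwardShift_pow (X := X) 1)
    · rw [Submodule.mem_comap]
      cases j with
      | zero => simpa using backwardShift_pow_mem_blockSum hL hp 1
      | succ j =>
        have h1 := backwardShift_pow_add_shift_pow 1 j p
        rw [pow_one, add_comm 1 j] at h1
        rw [h1]
        exact tensor_le_blockSum N L (shift_pow_mem_tensor hp j)
    · rw [Submodule.mem_comap, ← Module.End.mul_apply, ← pow_succ']
      exact backwardShift_pow_mem_blockSum hL hp _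
  exact h hg

theorem backwardShift_pow_mem_blockSum_of_mem {L : Submodule ℂ (H2 X)} (hL : L ≤ polyLE X N)
    {g : H2 X} (hg : g ∈ blockSum N L) (k : ℕ) : (backwardShift ^ k) g ∈ blockSum N L := by
  induction k with
  | zero => simpa using hg
  | succ k ih =>
    rw [pow_succ', Module.End.mul_apply]
    exact backwardShift_mem_blockSum hL ih

theorem blockSum_le_iInf {f : H2 X} {L : Submodule ℂ (H2 X)} (hL : L ≤ polyLE X N)
    (h : tensor L ≤ ⨅ k : ℕ, orbitSpan ((backwardShift ^ k) f)) :
    blockSum N L ≤ ⨅ k : ℕ, orbitSpan ((backwardShift ^ k) f) := by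
  refine le_iInf fun k => blockSum_le (isClosed_orbitSpan _) hL (fun p hp j => ?_) fun p hp i => ?_
  · exact (Submodule.mem_iInf _).1 (h (shift_pow_mem_tensor hp j)) k
  · refine orbitSpan_backwardShift_pow_le _ i (backwardShift_pow_mem_orbitSpan_of_mem ?_ i)
    exact (Submodule.mem_iInf _).1 (h (le_tensor L hp)) k

/-- The backward shift removes the polynomial part of `f`. -/
theorem exists_backwardShift_pow_mem_blockSum {f g p : H2 X} {L : Submodule ℂ (H2 X)} {M : ℕ}
    (hL : L ≤ polyLE X N) (hg : g ∈ tensor L) (hp : p ∈ polyLE X M) (hf : f = g + p) :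
    (backwardShift ^ (M + 1)) f ∈ blockSum N L := by
  have h0 : (backwardShift ^ (M + 1)) p = 0 := by
    ext m
    rw [backwardShift_pow_coeff, hp _ (by omega)]
    rfl
  rw [hf, map_add, h0, add_zero]
  exact backwardShift_pow_mem_blockSum_of_mem hL (tensor_le_blockSum N L hg) _

theorem orbitSpan_le_blockSum {f : H2 X} {L : Submodule ℂ (H2 X)} (hL : L ≤ polyLE X N) {d : ℕ}
    (hd : (backwardShift ^ d) f ∈ blockSum N L) :
    orbitSpan ((backwardShift ^ d) f) ≤ blockSum N L :=
  orbitSpan_le (isClosed_blockSum N L) fun k => backwardShift_pow_mem_blockSum_of_mem hL hd k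

theorem finiteDimensional_ker_backwardShift_pow [FiniteDimensional ℂ X] (d : ℕ) :
    FiniteDimensional ℂ (LinearMap.ker (backwardShift ^ d : H2 X →ₗ[ℂ] H2 X)) := by
  let φ : LinearMap.ker (backwardShift ^ d : H2 X →ₗ[ℂ] H2 X) →ₗ[ℂ] (Fin d → X) :=
    { toFun := fun g i => ((g : H2 X) : ℕ → X) i
      map_add' := fun _ _ => rfl
      map_smul' := fun _ _ => rfl }
  refine FiniteDimensional.of_injective φ ((injective_iff_map_eq_zero φ).2 fun g hg => ?_)
  ext m
  rcases lt_or_ge m d with h | h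
  · exact congrFun hg ⟨m, h⟩
  · have h1 : (backwardShift ^ d) (g : H2 X) = 0 := g.2
    have h2 := backwardShift_pow_coeff d (g : H2 X) (m - d)
    rw [h1, Nat.sub_add_cancel h] at h2
    exact h2.symm

/-- In finite dimension `S*^d` maps closed subspaces to closed subspaces, having a
finite-dimensional kernel and the right inverse `S^d`. -/
theorem isClosed_map_backwardShift_pow [FiniteDimensional ℂ X] {E : Submodule ℂ (H2 X)}
    (hE : IsClosed (E : Set (H2 X))) (d : ℕ) :
    IsClosed (E.map (backwardShift ^ d) : Set (H2 X)) := by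
  have := finiteDimensional_ker_backwardShift_pow (X := X) d
  have h1 := Submodule.isClosed_sup_finiteDimensional E
    (LinearMap.ker (backwardShift ^ d : H2 X →ₗ[ℂ] H2 X)) hE
  have h2 : E.map (backwardShift ^ d) =
      (E ⊔ LinearMap.ker (backwardShift ^ d : H2 X →ₗ[ℂ] H2 X)).comap (shift ^ d) := by
    ext g
    rw [Submodule.mem_comap, Submodule.mem_sup]
    constructor
    · rintro ⟨u, hu, rfl⟩
      refine ⟨u, hu, (shift ^ d) ((backwardShift ^ d) u) - u, ?_, by abel⟩
      rw [LinearMap.mem_ker, map_sub, backwardShift_pow_shift_pow, sub_self]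
    · rintro ⟨u, hu, k, hk, huk⟩
      refine ⟨u, hu, ?_⟩
      rw [← backwardShift_pow_shift_pow d g, ← huk, map_add, LinearMap.mem_ker.1 hk, add_zero]
  rw [h2]
  exact h1.preimage (continuous_shift_pow d)

end BlockSum

/-! ### Cyclicity and local rank -/

section Cyclic

variable {X : Type*} [NormedAddCommGroup X] [InnerProductSpace ℂ X] {N : ℕ}

theorem shift_pow_single (s m : ℕ) (x : X) :
    (shift ^ s) (lp.single 2 m x : H2 X) = lp.single 2 (s + m) x := by
  ext a
  rw [shift_pow_coeff, lp.single_apply, lp.single_apply, Pi.single_apply, Pi.single_apply]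
  split_ifs <;> first | rfl | omega

theorem backwardShift_pow_single_of_le {d m : ℕ} (h : d ≤ m) (x : X) :
    (backwardShift ^ d) (lp.single 2 m x : H2 X) = lp.single 2 (m - d) x := by
  ext a
  rw [backwardShift_pow_coeff, lp.single_apply, lp.single_apply, Pi.single_apply, Pi.single_apply]
  split_ifs <;> first | rfl | omega

theorem backwardShift_pow_single_of_lt {d m : ℕ} (h : m < d) (x : X) :
    (backwardShift ^ d) (lp.single 2 m x : H2 X) = 0 := by
  ext a
  rw [backwardShift_pow_coeff, lp.single_apply, Pi.single_apply, if_neg (by omega)]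
  rfl

theorem eval_eq_sum {p : H2 X} (hp : p ∈ polyLE X N) (z : ℂ) :
    eval p z = ∑ s ∈ Finset.range (N + 1), z ^ s • (p : ℕ → X) s :=
  tsum_eq_sum fun s hs => by rw [hp s (by simpa using hs), smul_zero]

theorem eq_sum_single {p : H2 X} (hp : p ∈ polyLE X N) :
    p = ∑ s ∈ Finset.range (N + 1), (lp.single 2 s ((p : ℕ → X) s) : H2 X) := by
  ext m
  rw [sum_coeff]
  simp only [lp.coeFn_single, Finset.sum_pi_single]
  split_ifs with h
  · rfl
  · exact hp m (by simpa using h)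

theorem aeval_shift_apply (q : Polynomial ℂ) (g : H2 X) :
    Polynomial.aeval (shift : Module.End ℂ (H2 X)) q g =
      ∑ l ∈ Finset.range (q.natDegree + 1), q.coeff l • (shift ^ l) g := by
  rw [Polynomial.aeval_eq_sum_range, LinearMap.sum_apply]
  rfl

/-- If `E` is closed and `S*`-invariant and contains `δ H²(𝔻, X)` for a nonzero polynomial `δ`,
then `E` is everything: `S*^D (δ z^m x)`, with `D` the degree of `δ`, is a nonzero multiple of
`z^m x` plus terms of lower degree. -/
theorem eq_top_of_aeval_shift_mem {E : Submodule ℂ (H2 X)} (hE : IsClosed (E : Set (H2 X)))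
    (hinv : ∀ g ∈ E, ∀ k, (backwardShift ^ k) g ∈ E) {δ : Polynomial ℂ} (hδ : δ ≠ 0)
    (h : ∀ m x, Polynomial.aeval (shift : Module.End ℂ (H2 X)) δ (lp.single 2 m x) ∈ E) :
    E = ⊤ := by
  have hsingle : ∀ m x, (lp.single 2 m x : H2 X) ∈ E := by
    intro m
    induction m using Nat.strong_induction_on with
    | _ m ih =>
      intro x
      have h1 := hinv _ (h m x) δ.natDegree
      rw [aeval_shift_apply, map_sum, Finset.sum_range_succ] at h1
      simp only [map_smul, shift_pow_single] at h1
      rw [backwardShift_pow_single_of_le (Nat.le_add_right _ _), Nat.add_sub_cancel_left] at h1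
      have h2 : ∑ l ∈ Finset.range δ.natDegree,
          δ.coeff l • (backwardShift ^ δ.natDegree) (lp.single 2 (l + m) x : H2 X) ∈ E := by
        refine Submodule.sum_mem _ fun l hl => Submodule.smul_mem _ _ ?_
        rw [Finset.mem_range] at hl
        rcases lt_or_ge (l + m) δ.natDegree with h3 | h3
        · rw [backwardShift_pow_single_of_lt h3]
          exact Submodule.zero_mem _
        · rw [backwardShift_pow_single_of_le h3]
          exact ih _ (by omega) x
      have h3 := (Submodule.add_mem_iff_right _ h2).1 h1
      exact (Submodule.smul_mem_iff _ (Polynomial.leadingCoeff_ne_zero.2 hδ)).1 h3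
  refine eq_top_iff.2 fun g _ => ?_
  exact hE.mem_of_tendsto (lp.hasSum_single (p := 2) (by norm_num) g)
    (Filter.Eventually.of_forall fun s => Submodule.sum_mem _ fun i _ => hsingle i _)

theorem aeval_shift_mem_tensor {L : Submodule ℂ (H2 X)} (hL : L ≤ polyLE X N) (q : Polynomial ℂ)
    {g : H2 X} (hg : g ∈ tensor L) :
    Polynomial.aeval (shift : Module.End ℂ (H2 X)) q g ∈ tensor L := by
  rw [aeval_shift_apply]
  refine Submodule.sum_mem _ fun l _ => Submodule.smul_mem _ _ ?_
  clear * - hL hg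
  induction l with
  | zero => simpa using hg
  | succ l ih =>
    rw [pow_succ', Module.End.mul_apply]
    exact map_shift_tensor_le hL ⟨_, ih, rfl⟩

/-- Cramer's rule for a ring of operators: if the vectors `p j` are the combinations of the
vectors `e i` with coefficient matrix `A`, then `A.det` maps each `e k` to a combination of the
`p j`. -/
theorem det_apply_eq_sum_adjugate {R M ι : Type*} [CommRing R] [AddCommGroup M] [Module ℂ M]
    [Fintype ι] [DecidableEq ι] (φ : R →+* Module.End ℂ M) (A : Matrix ι ι R) {e p : ι → M}
    (hp : ∀ j, p j = ∑ i, φ (A i j) (e i)) (k : ι) :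
    φ A.det (e k) = ∑ j, φ (A.adjugate j k) (p j) := by
  have h1 : ∀ i, ∑ j, A.adjugate j k * A i j = if i = k then A.det else 0 := by
    intro i
    have h2 := congrFun (congrFun A.mul_adjugate i) k
    rw [Matrix.mul_apply, Matrix.smul_apply, Matrix.one_apply, smul_eq_mul, mul_ite, mul_one,
      mul_zero] at h2
    rw [← h2]
    exact Finset.sum_congr rfl fun j _ => mul_comm _ _
  calc φ A.det (e k) = ∑ i, φ (∑ j, A.adjugate j k * A i j) (e i) := by
        rw [Finset.sum_eq_single k]
        · rw [h1, if_pos rfl]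
        · intro i _ hi
          rw [h1, if_neg hi, map_zero, LinearMap.zero_apply]
        · intro hk
          exact absurd (Finset.mem_univ k) hk
    _ = ∑ i, ∑ j, φ (A.adjugate j k * A i j) (e i) := by
        simp only [map_sum, LinearMap.sum_apply]
    _ = ∑ j, ∑ i, φ (A.adjugate j k * A i j) (e i) := Finset.sum_comm
    _ = ∑ j, φ (A.adjugate j k) (p j) := by
        refine Finset.sum_congr rfl fun j _ => ?_
        rw [hp j, map_sum]
        simp only [map_mul, Module.End.mul_apply]

/-- The matrix, with polynomial entries, of the coordinates of the polynomials `p j` in a basis of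
`X`. -/
noncomputable def coordMatrix {ι : Type*} (b : Module.Basis ι ℂ X) (N : ℕ) (p : ι → H2 X) :
    Matrix ι ι (Polynomial ℂ) := fun i j =>
  ∑ s ∈ Finset.range (N + 1), Polynomial.monomial s (b.repr ((p j : ℕ → X) s) i)

theorem eval_coordMatrix {ι : Type*} (b : Module.Basis ι ℂ X) {p : ι → H2 X}
    (hp : ∀ j, p j ∈ polyLE X N) (z : ℂ) (i j : ι) :
    Polynomial.eval z (coordMatrix b N p i j) = b.repr (eval (p j) z) i := by
  rw [eval_eq_sum (hp j), map_sum, Finsupp.finsetSum_apply, coordMatrix, Polynomial.eval_finsetSum]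
  refine Finset.sum_congr rfl fun s _ => ?_
  rw [Polynomial.eval_monomial, map_smul, Finsupp.smul_apply, smul_eq_mul, mul_comm]

theorem eq_sum_aeval_coordMatrix {ι : Type*} [Fintype ι] (b : Module.Basis ι ℂ X) {p : ι → H2 X}
    (hp : ∀ j, p j ∈ polyLE X N) (j : ι) :
    p j = ∑ i, Polynomial.aeval (shift : Module.End ℂ (H2 X)) (coordMatrix b N p i j)
      (lp.single 2 0 (b i)) := by
  have h1 : ∀ i, Polynomial.aeval (shift : Module.End ℂ (H2 X)) (coordMatrix b N p i j)
      (lp.single 2 0 (b i)) = ∑ s ∈ Finset.range (N + 1),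
        lp.lsingle (E := fun _ : ℕ => X) (𝕜 := ℂ) 2 s (b.repr ((p j : ℕ → X) s) i • b i) := by
    intro i
    rw [coordMatrix, map_sum, LinearMap.sum_apply]
    refine Finset.sum_congr rfl fun s _ => ?_
    rw [Polynomial.aeval_monomial, map_smul, Module.End.mul_apply, Module.algebraMap_end_apply,
      shift_pow_single, add_zero]
    rfl
  rw [Finset.sum_congr rfl fun i _ => h1 i, Finset.sum_comm]
  simp only [← map_sum, b.sum_repr]
  exact eq_sum_single (hp j)

/-- Full rank at one point yields a nonzero polynomial `δ` with `δ z^m x ∈ H² ⊗ L` for all `m` and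
`x`: the determinant of polynomials in `L` whose values at that point form a basis. -/
theorem exists_aeval_shift_mem_tensor [FiniteDimensional ℂ X] {L : Submodule ℂ (H2 X)}
    (hL : L ≤ polyLE X N) {z : ℂ} (hz : rankAt L z = Module.finrank ℂ X) :
    ∃ δ : Polynomial ℂ, δ ≠ 0 ∧ ∀ m x,
      Polynomial.aeval (shift : Module.End ℂ (H2 X)) δ (lp.single 2 m x) ∈ tensor L := by
  classical
  have htop : Submodule.span ℂ ((fun p => eval p z) '' (L : Set (H2 X))) = ⊤ :=
    Submodule.eq_top_of_finrank_eq hz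
  obtain ⟨ι, b, hb⟩ : ∃ (ι : Set X) (b : Module.Basis ι ℂ X),
      ∀ i, b i ∈ (fun p => eval p z) '' (L : Set (H2 X)) :=
    ⟨_, Module.Basis.ofSpan htop.ge, fun i => Module.Basis.ofSpan_subset htop.ge ⟨i, rfl⟩⟩
  have : Fintype ι := FiniteDimensional.fintypeBasisIndex b
  choose p hpL hpb using hb
  replace hpb : ∀ i, eval (p i) z = b i := hpb
  have hp : ∀ j, p j ∈ polyLE X N := fun j => hL (hpL j)
  have hA : (coordMatrix b N p).map (Polynomial.evalRingHom z) = 1 := by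
    ext i j
    rw [Matrix.map_apply, Polynomial.coe_evalRingHom, eval_coordMatrix b hp, hpb,
      Module.Basis.repr_self, Finsupp.single_apply, Matrix.one_apply]
    simp only [eq_comm]
  refine ⟨(coordMatrix b N p).det, fun h0 => ?_, fun m x => ?_⟩
  · have h1 := (Polynomial.evalRingHom z).map_det (coordMatrix b N p)
    rw [RingHom.mapMatrix_apply, hA, h0, Matrix.det_one, map_zero] at h1
    exact zero_ne_one h1
  have hk : ∀ k, Polynomial.aeval (shift : Module.End ℂ (H2 X)) (coordMatrix b N p).det
      (lp.single 2 0 (b k)) ∈ tensor L := by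
    intro k
    have h1 := det_apply_eq_sum_adjugate
      (Polynomial.aeval (shift : Module.End ℂ (H2 X))).toRingHom (coordMatrix b N p)
      (eq_sum_aeval_coordMatrix b hp) k
    refine Eq.mpr (congrArg (· ∈ tensor L) h1) ?_
    exact Submodule.sum_mem _ fun j _ => aeval_shift_mem_tensor hL _ (le_tensor L (hpL j))
  generalize (coordMatrix b N p).det = δ at hk
  have hx : Polynomial.aeval (shift : Module.End ℂ (H2 X)) δ (lp.single 2 0 x) ∈ tensor L := by
    have h1 : (lp.single 2 0 x : H2 X) = ∑ k, b.repr x k • (lp.single 2 0 (b k) : H2 X) := by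
      have h2 := map_sum (lp.lsingle (E := fun _ : ℕ => X) (𝕜 := ℂ) 2 0)
        (fun k => b.repr x k • b k) Finset.univ
      simp only [map_smul, b.sum_repr] at h2
      exact h2
    rw [h1, map_sum]
    exact Submodule.sum_mem _ fun k _ => by
      rw [map_smul]
      exact Submodule.smul_mem _ _ (hk k)
  have hm : Polynomial.aeval (shift : Module.End ℂ (H2 X)) δ (lp.single 2 m x) =
      Polynomial.aeval (shift : Module.End ℂ (H2 X)) ((Polynomial.X : Polynomial ℂ) ^ m)
        (Polynomial.aeval (shift : Module.End ℂ (H2 X)) δ (lp.single 2 0 x)) := by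
    rw [← Module.End.mul_apply, ← map_mul, mul_comm, map_mul, Module.End.mul_apply,
      Polynomial.aeval_X_pow, shift_pow_single, add_zero]
  rw [hm]
  exact aeval_shift_mem_tensor hL _ hx

theorem isCyclic_of_rankAt_eq [FiniteDimensional ℂ X] {f : H2 X} {L : Submodule ℂ (H2 X)}
    (hL : IsMaximalBlockSpace f N L) {z : ℂ} (hz : rankAt L z = Module.finrank ℂ X) :
    IsCyclic f := by
  obtain ⟨δ, hδ, h⟩ := exists_aeval_shift_mem_tensor hL.le_polyLE hz
  exact eq_top_of_aeval_shift_mem (isClosed_orbitSpan f)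
    (fun g hg k => orbitSpan_backwardShift_pow_le f k (backwardShift_pow_mem_orbitSpan_of_mem hg k))
    hδ fun m x => hL.tensor_le_orbitSpan (h m x)

theorem rankAt_zero_of_isCyclic {f : H2 X} {L : Submodule ℂ (H2 X)}
    (hL : IsMaximalBlockSpace f N L) (hf : IsCyclic f) : rankAt L 0 = Module.finrank ℂ X := by
  have htop : Submodule.span ℂ ((fun p => eval p 0) '' (L : Set (H2 X))) = ⊤ := by
    refine eq_top_iff.2 fun x _ => Submodule.subset_span ⟨lp.single 2 0 x, ?_, ?_⟩
    · refine hL.maximal _ (fun m hm => ?_) (by rw [hf]; exact le_top)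
      rw [lp.single_apply, Pi.single_apply, if_neg (by omega)]
    · refine (tsum_eq_single 0 fun m hm => ?_).trans ?_
      · rw [zero_pow hm, zero_smul]
      · rw [pow_zero, one_smul, lp.single_apply_self]
  rw [rankAt, htop, finrank_top]

end Cyclic

end Hardy

theorem mainTheorem8 {X : Type*} [NormedAddCommGroup X] [InnerProductSpace ℂ X]
    [CompleteSpace X] [TopologicalSpace.SeparableSpace X]
    (N : ℕ) (n : ℕ → ℕ) (hn : Hardy.IsLacunary n)
    (P : ℕ → Hardy.polyLE X N) (hP : Hardy.IsCRC P)
    (f : Hardy.H2 X) (hf : Hardy.IsBlockSeries f n P) :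
    (∃! L : Submodule ℂ (Hardy.H2 X), Hardy.IsMaximalBlockSpace f N L) ∧
    ∀ L : Submodule ℂ (Hardy.H2 X), Hardy.IsMaximalBlockSpace f N L →
      -- (i)
      ((Hardy.tensor L).map Hardy.shift ≤ Hardy.tensor L ∧
        Hardy.tensor L ≤ ⨅ k : ℕ, Hardy.orbitSpan ((Hardy.backwardShift ^ k) f) ∧
        (⨅ k : ℕ, Hardy.orbitSpan ((Hardy.backwardShift ^ k) f)) ≤ Hardy.orbitSpan f) ∧
      -- (ii)
      (∃ g ∈ Hardy.tensor L, ∃ p : Hardy.H2 X, (∃ M : ℕ, p ∈ Hardy.polyLE X M) ∧ f = g + p) ∧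
      -- (iii)
      ((⨅ k : ℕ, Hardy.orbitSpan ((Hardy.backwardShift ^ k) f)) = Hardy.blockSum N L ∧
        ∃ d : ℕ, (Hardy.backwardShift ^ d) f ∈ Hardy.blockSum N L ∧
          ((Hardy.orbitSpan f).map (Hardy.backwardShift ^ d)).topologicalClosure
            = Hardy.blockSum N L ∧
          (FiniteDimensional ℂ X →
            (Hardy.orbitSpan f).map (Hardy.backwardShift ^ d) = Hardy.blockSum N L)) ∧
      -- (iv)
      (FiniteDimensional ℂ X →
        (Hardy.IsCyclic f ↔
          IsGreatest {r : ℕ | ∃ z : ℂ, ‖z‖ < 1 ∧ r = Hardy.rankAt L z} (Module.finrank ℂ X))) := by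
  refine ⟨⟨Hardy.blockSpace f N, Hardy.isMaximalBlockSpace_blockSpace f N,
    fun L hL => hL.eq_blockSpace⟩, fun L hL => ?_⟩
  have hii : ∃ g ∈ Hardy.tensor L, ∃ p : Hardy.H2 X,
      (∃ M : ℕ, p ∈ Hardy.polyLE X M) ∧ f = g + p := by
    rw [hL.eq_blockSpace]
    exact Hardy.exists_eq_add_polynomial hn hP hf
  refine ⟨⟨Hardy.map_shift_tensor_le hL.le_polyLE, hL.tensor_le,
    iInf_le_of_le 0 (by simp)⟩, hii, ?_, fun hX => ⟨fun hc => ⟨?_, ?_⟩, ?_⟩⟩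
  · obtain ⟨g, hg, p, ⟨M, hp⟩, hfgp⟩ := hii
    have hd := Hardy.exists_backwardShift_pow_mem_blockSum hL.le_polyLE hg hp hfgp
    have hle := Hardy.orbitSpan_le_blockSum hL.le_polyLE hd
    have hge := Hardy.blockSum_le_iInf hL.le_polyLE hL.tensor_le
    have hcl : ((Hardy.orbitSpan f).map (Hardy.backwardShift ^ (M + 1))).topologicalClosure
        = Hardy.blockSum N L := by
      rw [Hardy.map_orbitSpan_topologicalClosure]
      exact le_antisymm hle (hge.trans (iInf_le _ _))
    refine ⟨le_antisymm ((iInf_le _ _).trans hle) hge, M + 1, hd, hcl, fun hX => ?_⟩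
    rw [← hcl]
    exact (Hardy.isClosed_map_backwardShift_pow
      (Hardy.isClosed_orbitSpan f) _).submodule_topologicalClosure_eq.symm
  · exact ⟨0, by simp, (Hardy.rankAt_zero_of_isCyclic hL hc).symm⟩
  · rintro r ⟨z, -, rfl⟩
    exact Submodule.finrank_le _
  · rintro ⟨⟨z, -, hz⟩, -⟩
    exact Hardy.isCyclic_of_rankAt_eq hL hz.symm
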